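/- **Model.** Let $\mu$ be either Lebesgue measure on $\mathbb R$ (continuous set-up) or counting measure on $\mathbb Z$ (discrete set-up), and let $V:\mathbb R\to\mathbb R\cup\{+\infty\}$ be measurable with $V(0)<\infty$ and $\kappa:=\int e^{-V}\,d\mu<\infty$; in the continuous set-up $e^{-V}$ is continuous. For $\varepsilon\ge 0$ and $N\ge 0$ let $$Z^{\mathrm f}_{\varepsilon,N}=\int e^{-\sum_{i=0}^{N-1}V(x_{i+1}-x_i)}\prod_{i=1}^N\big(1_{(x_i>0)}\mu(dx_i)+\varepsilon\,\delta_0(dx_i)\big)\quad(x_0=0),$$ $$Z^{\mathrm c}_{\varepsilon,N}=\int e^{-\sum_{i=0}^{N}V(x_{i+1}-x_i)}\prod_{i=1}^N\big(1_{(x_i>0)}\mu(dx_i)+\varepsilon\,\delta_0(dx_i)\big)\quad(x_0=x_{N+1}=0),$$ so that $Z^{\mathrm c}_{\varepsilon,0}=e^{-V(0)}$. Put $\gamma:=\sum_{n\ge1}Z^{\mathrm c}_{0,n-1}/\kappa^n$ and, when $\gamma<\infty$, $q(n):=\gamma^{-1}Z^{\mathrm c}_{0,n-1}/\kappa^n$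 for $n\ge1$. For $\delta>0$ let $$\widetilde Z^{\mathrm c}_{\delta,0}:=1,\qquad \widetilde Z^{\mathrm c}_{\delta,N}:=\frac{(\delta/\gamma)\,Z^{\mathrm c}_{\delta/\gamma,N-1}}{\kappa^N}\ (N\ge1),\qquad \widetilde Z^{\mathrm f}_{\delta,N}:=\frac{Z^{\mathrm f}_{\delta/\gamma,N}}{\kappa^N}.$$ Let $P(n)$ be the probability that $S_i>0$ for all $1\le i\le n$, where $S_i=Y_1+\dots+Y_i$ and the $Y_j$ are i.i.d. with law $\kappa^{-1}e^{-V(x)}\mu(dx)$. Write $a_n\sim b_n$ for $a_n/b_n\to1$. A measurable function $L:\mathbb R\to\mathbb R$ that is positive near $+\infty$ is slowly varying if $L(ct)/L(t)\to1$ as $t\to\infty$ for every $c>0$. **Lemma 4 (critical case $\delta=1$).** Assume that $\gamma<\infty$ and that, for some constant $c_q>0$ and some slowly varying functions $L,L'$, $$q(n)\sim c_q\,\frac{L(n)}{n^{3/2}}\qquad\text{and}\qquad P(n)\sim\frac{L'(n)}{\sqrt n}\qquad(n\to\infty).$$ Then, as $N\to\infty$, $$\widetilde Z^{\mathrm c}_{1,N}\sim\frac1{2\pi}\,\frac1{c_q\,L(N)\,\sqrt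 N}\qquad\text{and}\qquad \widetilde Z^{\mathrm f}_{1,N}\sim\frac{L'(N)}{2\,c_q\,L(N)}.$$ -/

import Mathlib

open MeasureTheory Filter Asymptotics
open scoped ENNReal NNReal

/-- `L` is slowly varying at infinity: it is measurable, positive near infinity, and
`L (c t) / L t → 1` as `t → ∞` for every `c > 0`. -/
structure SlowlyVarying (L : ℝ → ℝ) : Prop where
  measurable : Measurable L
  eventually_pos : ∀ᶠ t in atTop, 0 < L t
  tendsto_ratio : ∀ c : ℝ, 0 < c → Tendsto (fun t => L (c * t) / L t) atTop (nhds 1)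

namespace Wetting

/-- Counting measure on `ℤ`, viewed as a measure on `ℝ`. -/
noncomputable def intCount : Measure ℝ := Measure.sum fun k : ℤ => Measure.dirac (k : ℝ)

/-- The normalization `κ = ∫ exp (-V) dμ`. -/
noncomputable def kappa (μ : Measure ℝ) (V : ℝ → EReal) : ℝ≥0∞ :=
  ∫⁻ y, EReal.exp (-V y) ∂μ

/-- The a priori measure `μ` and the potential `V : ℝ → ℝ ∪ {+∞}` of a wetting model, in the
continuous or in the discrete set-up. -/
structure IsModel (μ : Measure ℝ) (V : ℝ → EReal) : Prop where
  measurable : Measurable V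
  ne_bot : ∀ x, V x ≠ ⊥
  setup : (μ = volume ∧ Continuous fun x => EReal.exp (-V x)) ∨ μ = intCount
  lt_top_zero : V 0 < ⊤
  kappa_lt_top : kappa μ V < ⊤

/-- The trajectory `0 = x₀, x₁, …, x_N, 0, 0, …`; the coordinate `x k` of the vector
is the height `x_{k+1}`. -/
def path {N : ℕ} (x : Fin N → ℝ) : ℕ → ℝ
  | 0 => 0
  | k + 1 => if h : k < N then x ⟨k, h⟩ else 0

/-- The free Hamiltonian `∑_{i=0}^{N-1} V (x_{i+1} - x_i)`, with `x₀ = 0`. -/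
noncomputable def hamFree (V : ℝ → EReal) {N : ℕ} (x : Fin N → ℝ) : EReal :=
  ∑ i ∈ Finset.range N, V (path x (i + 1) - path x i)

/-- The constrained Hamiltonian `∑_{i=0}^{N} V (x_{i+1} - x_i)`, with `x₀ = x_{N+1} = 0`. -/
noncomputable def hamCon (V : ℝ → EReal) {N : ℕ} (x : Fin N → ℝ) : EReal :=
  ∑ i ∈ Finset.range (N + 1), V (path x (i + 1) - path x i)

/-- The single site measure `1_{x > 0} μ(dx) + ε δ₀(dx)`. -/
noncomputable def siteMeasure (μ : Measure ℝ) (ε : ℝ≥0) : Measure ℝ :=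
  μ.restrict (Set.Ioi 0) + (ε : ℝ≥0∞) • Measure.dirac 0

/-- The free partition function `Z^f_{ε,N}`. -/
noncomputable def Zfree (μ : Measure ℝ) (V : ℝ → EReal) (ε : ℝ≥0) (N : ℕ) : ℝ≥0∞ :=
  ∫⁻ x : Fin N → ℝ, EReal.exp (-hamFree V x) ∂(Measure.pi fun _ => siteMeasure μ ε)

/-- The constrained partition function `Z^c_{ε,N}`; for `N = 0` it is `exp (-V 0)`. -/
noncomputable def Zcon (μ : Measure ℝ) (V : ℝ → EReal) (ε : ℝ≥0) (N : ℕ) : ℝ≥0∞ :=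
  ∫⁻ x : Fin N → ℝ, EReal.exp (-hamCon V x) ∂(Measure.pi fun _ => siteMeasure μ ε)

/-- `γ = ∑_{n ≥ 1} Z^c_{0,n-1} / κ^n`. -/
noncomputable def gam (μ : Measure ℝ) (V : ℝ → EReal) : ℝ≥0∞ :=
  ∑' n : ℕ, Zcon μ V 0 n / kappa μ V ^ (n + 1)

/-- `q(n) = γ⁻¹ Z^c_{0,n-1} / κ^n` for `n ≥ 1`, and `q(0) = 0`. If `γ = ∞`, then `q` vanishes
identically, so a relation `q(n) ∼ c L(n) / n^{3/2}` with `c > 0` can hold only if `γ < ∞`. -/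
noncomputable def q (μ : Measure ℝ) (V : ℝ → EReal) : ℕ → ℝ
  | 0 => 0
  | n + 1 => ((gam μ V)⁻¹ * (Zcon μ V 0 n / kappa μ V ^ (n + 1))).toReal

/-- The reward `ε = δ / γ` that corresponds to `δ`. -/
noncomputable def eps (μ : Measure ℝ) (V : ℝ → EReal) (δ : ℝ≥0) : ℝ≥0 :=
  ((δ : ℝ≥0∞) / gam μ V).toNNReal

/-- The rescaled constrained partition function: `1` for `N = 0`, and
`ε Z^c_{ε,N-1} / κ^N` with `ε = δ / γ` for `N ≥ 1`. -/
noncomputable def ZconTilde (μ : Measure ℝ) (V : ℝ → EReal) (δ : ℝ≥0) : ℕ → ℝ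
  | 0 => 1
  | N + 1 => ((eps μ V δ : ℝ≥0∞) * Zcon μ V (eps μ V δ) N / kappa μ V ^ (N + 1)).toReal

/-- The rescaled free partition function `Z^f_{ε,N} / κ^N` with `ε = δ / γ`. -/
noncomputable def ZfreeTilde (μ : Measure ℝ) (V : ℝ → EReal) (δ : ℝ≥0) (N : ℕ) : ℝ :=
  (Zfree μ V (eps μ V δ) N / kappa μ V ^ N).toReal

/-- The law `κ⁻¹ exp (-V(x)) μ(dx)` of one step of the random walk. -/
noncomputable def stepLaw (μ : Measure ℝ) (V : ℝ → EReal) : Measure ℝ :=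
  (kappa μ V)⁻¹ • μ.withDensity fun x => EReal.exp (-V x)

/-- The probability `P(S₁ > 0, …, S_n > 0)` for the random walk `S_i = Y₁ + ⋯ + Y_i` whose steps
are independent with law `stepLaw μ V`. -/
noncomputable def P (μ : Measure ℝ) (V : ℝ → EReal) (n : ℕ) : ℝ :=
  ((Measure.pi fun _ : Fin n => stepLaw μ V)
    {y | ∀ i : Fin n, 0 < ∑ j ∈ Finset.Iic i, y j}).toReal

end Wetting

/-! At criticality the model is a renewal process. Cutting a trajectory at its first contact with
the origin shows that `ZconTilde μ V 1` is the renewal sequence `u` of the probability sequence `q`.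
With generating functions, U(1 - Q) = 1. The same cut for free trajectories gives F = P + QF, hence
F = UP. The first asymptotics is therefore a local renewal theorem of index -3/2
(`IsRenewal.tendsto_u`), and the second follows by convolving it with P
(`tendsto_sum_antidiagonal_mul`).

The local theorem rests on exact power series identities. Let T = (1 - Q)/(1 - X) be the series of
the tails, which behave like 2c L(n)/√n (`tendsto_tail`), and let B = (1 - X)^(-1/2). Since UT =
1/(1 - X), one has U(TB) = B/(1 - X). The coefficients of TB are asymptotic to a multiple of L(n),
so they can be pulled out of the convolution. This yields ∑ u_k ∼ √n/(π c L(n)) without a Tauberian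
theorem (`IsRenewal.tendsto_sum_u`).

To pass from sums to single terms, differentiate: U' = Q'U². The coefficients (i + 1) q(i + 1) of Q'
are asymptotic to one half of the tails, and TU² = U/(1 - X). Hence (n + 1) u(n + 1) is close to
half of ∑ u_k, which gives u_n ∼ 1/(2π c L(n) √n). The error is negligible because the coefficients
of U² are O(1/L²). This needs the a priori bound u_n = O(1/(L(n) √n)), proved by an induction on the
same identity (`IsRenewal.exists_u_le`).

All estimates separate a bulk, where slow variation is uniform, from an edge of relative size θ⁴,
where Potter's bound with exponent 1/4 suffices. This is why everything is measured in powers of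
`rho`: √n is `rho n ^ 2`, n is `rho n ^ 4`, and a Potter factor is one power of `rho`. -/

open Finset.HasAntidiagonal (antidiagonal)

/-! ### The fourth-root scale and its elementary sums. -/

/-- The fourth root of `n + 1`. -/
noncomputable def rho (n : ℕ) : ℝ := ((n : ℝ) + 1) ^ (1 / 4 : ℝ)

lemma rho_pos (n : ℕ) : 0 < rho n := Real.rpow_pos_of_pos (by positivity) _

lemma rho_pow_four (n : ℕ) : rho n ^ 4 = n + 1 := by
  rw [rho, ← Real.rpow_natCast, ← Real.rpow_mul (by positivity)]
  norm_num

lemma rho_sq (n : ℕ) : rho n ^ 2 = Real.sqrt (n + 1) := by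
  rw [eq_comm, Real.sqrt_eq_iff_mul_self_eq (by positivity) (by have := rho_pos n; positivity),
    ← rho_pow_four]
  ring

lemma rho_le_of_le {n : ℕ} {x : ℝ} (hx : 0 ≤ x) (h : (n : ℝ) + 1 ≤ x ^ 4) : rho n ≤ x := by
  rw [← rho_pow_four] at h
  exact le_of_pow_le_pow_left₀ (by norm_num) hx h

lemma le_rho_of_le {n : ℕ} {x : ℝ} (h : x ^ 4 ≤ (n : ℝ) + 1) : x ≤ rho n := by
  rw [← rho_pow_four] at h
  exact le_of_pow_le_pow_left₀ (by norm_num) (rho_pos n).le h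

lemma rho_mono {m n : ℕ} (h : m ≤ n) : rho m ≤ rho n := by
  refine rho_le_of_le (rho_pos n).le ?_
  rw [rho_pow_four]
  gcongr

lemma rho_succ_le (n : ℕ) : rho (n + 1) ≤ 2 * rho n := by
  refine rho_le_of_le (by have := rho_pos n; positivity) ?_
  rw [mul_pow, rho_pow_four]
  push_cast
  have : (0 : ℝ) ≤ n := by positivity
  linarith

lemma tendsto_rho : Tendsto rho atTop atTop := by
  have h : Tendsto (fun n : ℕ => (n : ℝ) + 1) atTop atTop :=
    tendsto_natCast_atTop_atTop.atTop_add tendsto_const_nhds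
  exact (tendsto_rpow_atTop (by norm_num : (0 : ℝ) < 1 / 4)).comp h

lemma rho_half_le {m n : ℕ} (h : (n : ℝ) + 1 ≤ 16 * (m + 1)) : rho n ≤ 2 * rho m := by
  refine rho_le_of_le (by have := rho_pos m; positivity) ?_
  rw [mul_pow, rho_pow_four]
  linarith

/-- Each term is at most four times the increment of the fourth root over the same unit step, so the
sum telescopes. -/
lemma sum_inv_rho_cube_le (M : ℕ) :
    ∑ i ∈ Finset.range M, 1 / rho i ^ 3 ≤ 4 * (M : ℝ) ^ (1 / 4 : ℝ) := by
  induction M with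
  | zero => simp
  | succ M ih =>
    rw [Finset.sum_range_succ]
    have h1 : (((M + 1 : ℕ) : ℝ)) ^ (1 / 4 : ℝ) = rho M := by simp [rho]
    rw [h1]
    set y := (M : ℝ) ^ (1 / 4 : ℝ) with hy
    have hy0 : 0 ≤ y := by positivity
    have hy4 : y ^ 4 = M := by
      rw [hy, ← Real.rpow_natCast, ← Real.rpow_mul (by positivity)]; norm_num
    have hx := rho_pos M
    have hx4 := rho_pow_four M
    have hyx : y ≤ rho M := le_rho_of_le (by rw [hy4]; linarith)
    have key : 1 ≤ (rho M - y) * (4 * rho M ^ 3) := by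
      have e : 1 = (rho M - y) * (rho M ^ 3 + rho M ^ 2 * y + rho M * y ^ 2 + y ^ 3) := by
        linear_combination hy4 - hx4
      rw [e]
      refine mul_le_mul_of_nonneg_left ?_ (sub_nonneg.2 hyx)
      have a1 : rho M ^ 2 * y ≤ rho M ^ 2 * rho M := by gcongr
      have a2 : rho M * y ^ 2 ≤ rho M * rho M ^ 2 := by gcongr
      have a3 : y ^ 3 ≤ rho M ^ 3 := by gcongr
      nlinarith
    have : 1 / rho M ^ 3 ≤ 4 * (rho M - y) := by
      rw [div_le_iff₀ (by positivity)]; linarith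
    linarith

/-- The cutoff is a fourth power so that the edge costs exactly a factor θ. This makes every edge
contribution below small. -/
lemma sum_inv_rho_cube_filter_le (n : ℕ) {θ : ℝ} (hθ : 0 ≤ θ) :
    ∑ i ∈ Finset.range (n + 1), (if (i : ℝ) + 1 ≤ θ ^ 4 * (n + 1) then 1 / rho i ^ 3 else 0)
      ≤ 4 * (θ * rho n) := by
  rw [← Finset.sum_filter]
  set M := ⌊θ ^ 4 * ((n : ℝ) + 1)⌋₊
  have hM : (M : ℝ) ≤ (θ * rho n) ^ 4 := by
    rw [mul_pow, rho_pow_four]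
    exact Nat.floor_le (by positivity)
  have hρ := rho_pos n
  calc _ ≤ ∑ i ∈ Finset.range M, 1 / rho i ^ 3 := by
        refine Finset.sum_le_sum_of_subset_of_nonneg ?_ ?_
        · intro i hi
          rw [Finset.mem_filter] at hi
          rw [Finset.mem_range]
          have : i + 1 ≤ M := Nat.le_floor (by push_cast; exact hi.2)
          omega
        · intro i _ _
          have := rho_pos i
          positivity
    _ ≤ 4 * (M : ℝ) ^ (1 / 4 : ℝ) := sum_inv_rho_cube_le M
    _ ≤ 4 * (((θ * rho n) ^ 4) ^ (1 / 4 : ℝ)) := by gcongr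
    _ = 4 * (θ * rho n) := by
        congr 1
        rw [← Real.rpow_natCast, ← Real.rpow_mul (by positivity)]
        norm_num

lemma sum_antidiagonal_fst_inv_rho_cube_filter_le (n : ℕ) {θ : ℝ} (hθ : 0 ≤ θ) :
    ∑ p ∈ antidiagonal n,
      (if (p.1 : ℝ) + 1 ≤ θ ^ 4 * (n + 1) then 1 / rho p.1 ^ 3 else 0) ≤ 4 * (θ * rho n) := by
  rw [Finset.Nat.sum_antidiagonal_eq_sum_range_succ_mk]
  exact sum_inv_rho_cube_filter_le n hθ

lemma sum_antidiagonal_snd_inv_rho_cube_filter_le (n : ℕ) {θ : ℝ} (hθ : 0 ≤ θ) :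
    ∑ p ∈ antidiagonal n,
      (if (p.2 : ℝ) + 1 ≤ θ ^ 4 * (n + 1) then 1 / rho p.2 ^ 3 else 0) ≤ 4 * (θ * rho n) := by
  rw [← Finset.Nat.sum_antidiagonal_swap]
  exact sum_antidiagonal_fst_inv_rho_cube_filter_le n hθ

lemma sum_antidiagonal_fst_inv_rho_cube_le (n : ℕ) :
    ∑ p ∈ antidiagonal n, 1 / rho p.1 ^ 3 ≤ 4 * rho n := by
  rw [Finset.Nat.sum_antidiagonal_eq_sum_range_succ_mk]
  refine (sum_inv_rho_cube_le _).trans_eq ?_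
  simp [rho]

lemma sum_antidiagonal_snd_inv_rho_cube_le (n : ℕ) :
    ∑ p ∈ antidiagonal n, 1 / rho p.2 ^ 3 ≤ 4 * rho n := by
  rw [← Finset.Nat.sum_antidiagonal_swap]
  exact sum_antidiagonal_fst_inv_rho_cube_le n

lemma rho_le_two_mul_of_antidiagonal {n : ℕ} {p : ℕ × ℕ} (hp : p ∈ antidiagonal n)
    (h : p.1 ≤ p.2) : rho n ≤ 2 * rho p.2 := by
  rw [Finset.HasAntidiagonal.mem_antidiagonal] at hp
  refine rho_half_le ?_
  have : (n : ℝ) ≤ 2 * p.2 := by exact_mod_cast (by omega : n ≤ 2 * p.2)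
  have : (0 : ℝ) ≤ p.2 := by positivity
  linarith

/-- The larger of the two indices is at least n/2, so its factor is comparable to a power of `rho
n`. The exponents 3/4 and 1/4 add up to 1, which makes the convolution bounded. -/
lemma inv_rho_cube_mul_inv_rho_le {n : ℕ} {p : ℕ × ℕ} (hp : p ∈ antidiagonal n) :
    1 / (rho p.1 ^ 3 * rho p.2) ≤ 2 / rho n * (1 / rho p.1 ^ 3) + 8 / rho n * (1 / rho p.2 ^ 3) := by
  have hn := rho_pos n
  have h1 := rho_pos p.1
  have h2 := rho_pos p.2
  rcases le_total p.1 p.2 with h | h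
  · have := rho_le_two_mul_of_antidiagonal hp h
    have e : 1 / rho p.2 ≤ 2 / rho n := by
      rw [div_le_div_iff₀ h2 hn]; linarith
    calc 1 / (rho p.1 ^ 3 * rho p.2) = 1 / rho p.2 * (1 / rho p.1 ^ 3) := by field_simp
      _ ≤ 2 / rho n * (1 / rho p.1 ^ 3) := by gcongr
      _ ≤ _ := le_add_of_nonneg_right (by positivity)
  · have hp' : p.swap ∈ antidiagonal n := by
      rw [Finset.HasAntidiagonal.mem_antidiagonal] at hp ⊢; simp only [Prod.fst_swap, Prod.snd_swap]; omega
    have h4 : rho n ≤ 2 * rho p.1 := rho_le_two_mul_of_antidiagonal hp' h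
    have h5 : rho p.2 ≤ rho n := rho_mono (by rw [Finset.HasAntidiagonal.mem_antidiagonal] at hp; omega)
    have e : 1 / (rho p.1 ^ 3 * rho p.2) ≤ 8 / rho n * (1 / rho p.2 ^ 3) := by
      rw [div_mul_div_comm, div_le_div_iff₀ (by positivity) (by positivity)]
      have : rho n ^ 3 ≤ (2 * rho p.1) ^ 3 := by gcongr
      have : rho n * rho p.2 ^ 2 ≤ rho n * rho n ^ 2 := by gcongr
      have : rho n * rho p.2 ^ 2 * rho p.2 ≤ 8 * rho p.1 ^ 3 * rho p.2 :=
        mul_le_mul_of_nonneg_right (by linarith) h2.le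
      linarith
    refine e.trans (le_add_of_nonneg_left (by positivity))

lemma sum_antidiagonal_inv_rho_cube_mul_inv_rho_le (n : ℕ) :
    ∑ p ∈ antidiagonal n, 1 / (rho p.1 ^ 3 * rho p.2) ≤ 40 := by
  have hn := rho_pos n
  calc _ ≤ ∑ p ∈ antidiagonal n,
        (2 / rho n * (1 / rho p.1 ^ 3) + 8 / rho n * (1 / rho p.2 ^ 3)) :=
        Finset.sum_le_sum fun p hp => inv_rho_cube_mul_inv_rho_le hp
    _ = 2 / rho n * ∑ p ∈ antidiagonal n, 1 / rho p.1 ^ 3 +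
        8 / rho n * ∑ p ∈ antidiagonal n, 1 / rho p.2 ^ 3 := by
        rw [Finset.sum_add_distrib, Finset.mul_sum, Finset.mul_sum]
    _ ≤ 2 / rho n * (4 * rho n) + 8 / rho n * (4 * rho n) := by
        gcongr
        · exact sum_antidiagonal_fst_inv_rho_cube_le n
        · exact sum_antidiagonal_snd_inv_rho_cube_le n
    _ = 40 := by field_simp; norm_num

/-! ### Slowly varying sequences and Potter's bound. -/

/-- A positive sequence which is slowly varying, with the locally uniform convergence built in. -/
structure SVSeq (l : ℕ → ℝ) : Prop where
  pos : ∀ n, 0 < l n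
  unif : ∀ η : ℝ, 0 < η → ∀ ε : ℝ, 0 < ε → ∀ᶠ n : ℕ in atTop, ∀ m : ℕ, m ≤ n → η * n ≤ m →
    |l m / l n - 1| ≤ ε

lemma SVSeq.inv {l : ℕ → ℝ} (h : SVSeq l) : SVSeq fun n => (l n)⁻¹ := by
  refine ⟨fun n => inv_pos.2 (h.pos n), fun η hη ε hε => ?_⟩
  filter_upwards [h.unif η hη (min (1 / 2) (ε / 2)) (by positivity)] with n hn m hm hmn
  have h1 := hn m hm hmn
  have h2 : |l m / l n - 1| ≤ 1 / 2 := h1.trans (min_le_left _ _)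
  have h3 : |l m / l n - 1| ≤ ε / 2 := h1.trans (min_le_right _ _)
  have e : (l m)⁻¹ / (l n)⁻¹ = (l m / l n)⁻¹ := by
    have := h.pos m; have := h.pos n; field_simp
  rw [e]
  set x := l m / l n
  have hx : 1 / 2 ≤ x := by linarith [(abs_le.1 h2).1]
  have : x⁻¹ - 1 = -(x - 1) / x := by field_simp; ring
  rw [this, abs_div, abs_neg, abs_of_pos (by linarith : 0 < x), div_le_iff₀ (by linarith)]
  nlinarith

lemma SVSeq.mul {l l' : ℕ → ℝ} (h : SVSeq l) (h' : SVSeq l') : SVSeq fun n => l n * l' n := by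
  refine ⟨fun n => mul_pos (h.pos n) (h'.pos n), fun η hη ε hε => ?_⟩
  filter_upwards [h.unif η hη (min 1 (ε / 3)) (by positivity),
    h'.unif η hη (min 1 (ε / 3)) (by positivity)] with n hn hn' m hm hmn
  have h1 := hn m hm hmn
  have h2 := hn' m hm hmn
  have e : l m * l' m / (l n * l' n) = (l m / l n) * (l' m / l' n) := by
    rw [mul_div_mul_comm]
  rw [e]
  set x := l m / l n
  set y := l' m / l' n
  have e2 : x * y - 1 = (x - 1) * (y - 1) + (x - 1) + (y - 1) := by ring
  rw [e2]
  have h3 : |(x - 1) * (y - 1)| ≤ ε / 3 := by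
    rw [abs_mul]
    calc _ ≤ 1 * (ε / 3) := mul_le_mul (h1.trans (min_le_left _ _)) (h2.trans (min_le_right _ _))
          (abs_nonneg _) zero_le_one
      _ = _ := one_mul _
  calc _ ≤ |(x - 1) * (y - 1)| + |x - 1| + |y - 1| := abs_add_three _ _ _
    _ ≤ ε / 3 + ε / 3 + ε / 3 := by
        gcongr
        · exact h1.trans (min_le_right _ _)
        · exact h2.trans (min_le_right _ _)
    _ = ε := by ring

lemma svSeq_one : SVSeq fun _ => 1 :=
  ⟨fun _ => one_pos, fun _ _ ε hε => by simp [hε.le]⟩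

/-- Potter's bound. -/
lemma SVSeq.potter {l : ℕ → ℝ} (h : SVSeq l) :
    ∃ C : ℝ, 1 ≤ C ∧ ∀ m n : ℕ, m ≤ n → l m * rho m ≤ C * (rho n * l n) := by
  -- Halving the index costs a factor 9/8 in `l` and gains almost 2^(1/4) > 9/8 in `rho`, so the
  -- induction from n/2 to n keeps the same constant. The window 1/3 leaves room for the rounding in
  -- n/2, and n ≥ 4 for the shift in `rho`.
  obtain ⟨N, hN⟩ := eventually_atTop.1 (h.unif (1 / 3) (by norm_num) (1 / 8) (by norm_num))
  set N0 := max N 4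
  obtain ⟨C0, hC0⟩ := ((Finset.range N0 ×ˢ Finset.range N0).finite_toSet.image
    (fun p : ℕ × ℕ => l p.1 * rho p.1 / (rho p.2 * l p.2))).bddAbove
  refine ⟨max C0 2, by simp, fun m n => ?_⟩
  set C := max C0 2
  have hC2 : 2 ≤ C := le_max_right _ _
  induction n using Nat.strong_induction_on with
  | _ n ih =>
    intro hmn
    have hln := h.pos n
    have hρn := rho_pos n
    have hρm := rho_pos m
    by_cases hn : n < N0
    · have : l m * rho m / (rho n * l n) ≤ C0 := by
        refine hC0 ⟨(m, n), ?_, rfl⟩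
        simp only [Finset.coe_product, Finset.coe_range, Set.mem_prod, Set.mem_Iio]
        omega
      rw [div_le_iff₀ (by positivity)] at this
      refine this.trans ?_
      gcongr
      exact le_max_left _ _
    · have hnN : N ≤ n := by omega
      have hn4 : 4 ≤ n := by omega
      have hn4' : (4 : ℝ) ≤ n := by exact_mod_cast hn4
      have key : ∀ k : ℕ, k ≤ n → n / 2 ≤ k → l k ≤ 9 / 8 * l n := by
        intro k hk hk2
        have : (n : ℝ) ≤ 2 * k + 1 := by exact_mod_cast (by omega : n ≤ 2 * k + 1)
        have := hN n hnN k hk (by linarith)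
        have := (abs_le.1 this).2
        rw [← div_le_iff₀ hln]
        linarith
      by_cases hm : n / 2 ≤ m
      · calc l m * rho m ≤ (9 / 8 * l n) * rho n := by
              gcongr
              · exact key m hmn hm
              · exact rho_mono hmn
          _ ≤ C * (rho n * l n) := by
              have : 0 < rho n * l n := by positivity
              nlinarith
      · have h1 := ih (n / 2) (by omega) (by omega)
        have h2 := key (n / 2) (by omega) le_rfl
        have h3 : 9 / 8 * rho (n / 2) ≤ rho n := by
          refine le_rho_of_le ?_
          rw [mul_pow, rho_pow_four]
          have : ((n / 2 : ℕ) : ℝ) ≤ n / 2 := Nat.cast_div_le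
          norm_num
          linarith
        have hρ2 := rho_pos (n / 2)
        calc l m * rho m ≤ C * (rho (n / 2) * l (n / 2)) := h1
          _ ≤ C * (rho (n / 2) * (9 / 8 * l n)) := by gcongr
          _ = C * (9 / 8 * rho (n / 2) * l n) := by ring
          _ ≤ C * (rho n * l n) := by gcongr

lemma SVSeq.eventually_of_le {θ : ℝ} (hθ : 0 < θ) {p : ℕ → Prop} (hp : ∀ᶠ n in atTop, p n) :
    ∀ᶠ n : ℕ in atTop, ∀ m : ℕ, θ * ((n : ℝ) + 1) ≤ m + 1 → p m := by
  obtain ⟨N, hN⟩ := eventually_atTop.1 hp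
  obtain ⟨K, hK⟩ := exists_nat_gt ((N : ℝ) / θ)
  filter_upwards [eventually_ge_atTop K] with n hn m hm
  refine hN m ?_
  rw [div_lt_iff₀ hθ] at hK
  have : (K : ℝ) ≤ n := by exact_mod_cast hn
  have : (N : ℝ) < m + 1 := by nlinarith
  exact Nat.lt_succ_iff.1 (by exact_mod_cast this)

lemma SVSeq.unif' {l : ℕ → ℝ} (h : SVSeq l) {η : ℝ} (hη : 0 < η) {ε : ℝ} (hε : 0 < ε) :
    ∀ᶠ n : ℕ in atTop, ∀ m : ℕ, m ≤ n → η * ((n : ℝ) + 1) ≤ m + 1 → |l m / l n - 1| ≤ ε := by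
  have h1 := h.unif (η / 2) (by positivity) ε hε
  obtain ⟨K, hK⟩ := exists_nat_gt (2 / η)
  filter_upwards [h1, eventually_ge_atTop K] with n hn hnK m hm hmn
  refine hn m hm ?_
  have : (K : ℝ) ≤ n := by exact_mod_cast hnK
  rw [div_lt_iff₀ hη] at hK
  nlinarith

/-! ### The model sequence of index -1/2 and convolutions of that index. -/

/-- The sequence `binom (2 n) n / 4 ^ n`, the coefficients of `(1 - X)^(-1/2)`. -/
noncomputable def invSqrtCoeff (n : ℕ) : ℝ :=
  ∏ i ∈ Finset.range n, (2 * (i : ℝ) + 1) / (2 * i + 2)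

lemma invSqrtCoeff_zero : invSqrtCoeff 0 = 1 := by simp [invSqrtCoeff]

lemma invSqrtCoeff_succ (n : ℕ) :
    invSqrtCoeff (n + 1) * (2 * n + 2) = invSqrtCoeff n * (2 * n + 1) := by
  rw [invSqrtCoeff, Finset.prod_range_succ, ← invSqrtCoeff]
  field_simp

lemma invSqrtCoeff_pos (n : ℕ) : 0 < invSqrtCoeff n :=
  Finset.prod_pos fun i _ => by positivity

lemma sum_invSqrtCoeff (n : ℕ) :
    ∑ k ∈ Finset.range (n + 1), invSqrtCoeff k = (2 * n + 1) * invSqrtCoeff n := by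
  induction n with
  | zero => simp
  | succ n ih =>
    rw [Finset.sum_range_succ, ih]
    have := invSqrtCoeff_succ n
    push_cast
    linarith

/-- The link with the Wallis product, and the only source of π in the argument. -/
lemma invSqrtCoeff_sq_mul (n : ℕ) : invSqrtCoeff n ^ 2 * ((2 * n + 1) * Real.Wallis.W n) = 1 := by
  induction n with
  | zero => simp [invSqrtCoeff, Real.Wallis.W]
  | succ n ih =>
    have h : invSqrtCoeff (n + 1) = invSqrtCoeff n * ((2 * n + 1) / (2 * n + 2)) := by
      rw [invSqrtCoeff, Finset.prod_range_succ, ← invSqrtCoeff]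
    rw [Real.Wallis.W_succ, h]
    refine Eq.trans ?_ ih
    push_cast
    field_simp
    ring

lemma tendsto_invSqrtCoeff_mul_rho_sq :
    Tendsto (fun n => invSqrtCoeff n * rho n ^ 2) atTop (nhds (1 / Real.sqrt Real.pi)) := by
  have h : ∀ n : ℕ, invSqrtCoeff n * rho n ^ 2 =
      Real.sqrt (((n : ℝ) + 1) / (2 * n + 1) * (Real.Wallis.W n)⁻¹) := by
    intro n
    have hW := Real.Wallis.W_pos n
    rw [eq_comm, Real.sqrt_eq_iff_mul_self_eq (by positivity)
      (by have := rho_pos n; have := invSqrtCoeff_pos n; positivity)]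
    have := invSqrtCoeff_sq_mul n
    have e : invSqrtCoeff n * rho n ^ 2 * (invSqrtCoeff n * rho n ^ 2) =
      invSqrtCoeff n ^ 2 * rho n ^ 4 := by ring
    rw [e, rho_pow_four, ← div_eq_mul_inv, div_div, mul_comm, div_eq_iff (by positivity)]
    linear_combination -((n : ℝ) + 1) * this
  simp_rw [h]
  have h1 : Tendsto (fun n : ℕ => ((n : ℝ) + 1) / (2 * n + 1)) atTop (nhds (1 / 2)) := by
    have h2 : Tendsto (fun n : ℕ => 1 / 2 + (1 / 2) / (2 * (n : ℝ) + 1)) atTop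
        (nhds (1 / 2 + 0)) := by
      refine tendsto_const_nhds.add (tendsto_const_nhds.div_atTop ?_)
      exact (tendsto_natCast_atTop_atTop.const_mul_atTop two_pos).atTop_add tendsto_const_nhds
    rw [add_zero] at h2
    refine h2.congr fun n => ?_
    field_simp
    ring
  have h3 := (h1.mul (Real.Wallis.tendsto_W_nhds_pi_div_two.inv₀ (by positivity))).sqrt
  convert h3 using 2
  rw [← Real.sqrt_one, ← Real.sqrt_div zero_le_one]
  congr 1
  simp
  field_simp

lemma exists_abs_le_of_tendsto {x : ℕ → ℝ} {a : ℝ} (h : Tendsto x atTop (nhds a)) :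
    ∃ C : ℝ, 0 < C ∧ ∀ n, |x n| ≤ C := by
  obtain ⟨C, hC⟩ := h.abs.bddAbove_range
  exact ⟨max C 1, by positivity, fun n => (hC ⟨n, rfl⟩).trans (le_max_left _ _)⟩

/-- The recursion of the coefficients is the differential equation 2(1 - X)C' = C, which makes the
derivative of (1 - X)C² vanish. -/
lemma mk_invSqrtCoeff_sq :
    (1 - PowerSeries.X) * PowerSeries.mk invSqrtCoeff ^ 2 = 1 := by
  set C : PowerSeries ℝ := PowerSeries.mk invSqrtCoeff with hC
  have h : 2 * (1 - PowerSeries.X) * PowerSeries.derivative ℝ C = C := by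
    have e : 2 * (1 - PowerSeries.X) * PowerSeries.derivative ℝ C =
      PowerSeries.C 2 * PowerSeries.derivative ℝ C -
      PowerSeries.C 2 * (PowerSeries.X * PowerSeries.derivative ℝ C) := by
      rw [map_ofNat]; ring
    rw [e]
    ext n
    rw [map_sub, PowerSeries.coeff_C_mul, PowerSeries.coeff_C_mul]
    cases n with
    | zero =>
      have := invSqrtCoeff_succ 0
      rw [PowerSeries.coeff_derivative, PowerSeries.coeff_zero_X_mul]
      simp [hC] at this ⊢
      linarith
    | succ n =>
      have := invSqrtCoeff_succ (n + 1)
      rw [PowerSeries.coeff_succ_X_mul, PowerSeries.coeff_derivative,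
        PowerSeries.coeff_derivative]
      simp [hC] at this ⊢
      linarith
  refine PowerSeries.derivative.ext (R := ℝ) ?_ ?_
  · rw [Derivation.leibniz, PowerSeries.derivative_pow]
    simp only [map_sub, PowerSeries.derivative_one, PowerSeries.derivative_X, smul_eq_mul,
      Nat.cast_ofNat]
    linear_combination C * h
  · simp [hC, invSqrtCoeff_zero]

/-- An exact discrete form of the Beta integral B(1/2, 1/2). It provides weights of total mass one
against which other convolutions are compared. -/
lemma sum_antidiagonal_invSqrtCoeff (n : ℕ) :
    ∑ p ∈ antidiagonal n, invSqrtCoeff p.1 * invSqrtCoeff p.2 = 1 := by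
  have h1 := mk_invSqrtCoeff_sq
  have h2 : (1 - PowerSeries.X) * PowerSeries.mk (1 : ℕ → ℝ) = 1 := by
    rw [mul_comm]; exact PowerSeries.mk_one_mul_one_sub_eq_one ℝ
  have h3 : PowerSeries.mk invSqrtCoeff ^ 2 = PowerSeries.mk (1 : ℕ → ℝ) := by
    calc _ = (1 - PowerSeries.X) * PowerSeries.mk (1 : ℕ → ℝ) *
          PowerSeries.mk invSqrtCoeff ^ 2 := by rw [h2, one_mul]
      _ = (1 - PowerSeries.X) * PowerSeries.mk invSqrtCoeff ^ 2 * PowerSeries.mk (1 : ℕ → ℝ) := by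
        ring
      _ = _ := by rw [h1, one_mul]
  have h4 := congrArg (PowerSeries.coeff n) h3
  rw [pow_two, PowerSeries.coeff_mul] at h4
  simpa using h4

/-- Dominated convergence for convolutions: in the bulk the terms are small relative to weights of
total mass one, and near either end the majorant sums to O(θ). -/
lemma tendsto_sum_antidiagonal_zero {f : ℕ → ℕ × ℕ → ℝ} {C : ℝ} (hC0 : 0 < C)
    (hC : ∀ n, ∀ p ∈ antidiagonal n, |f n p| ≤ C * (rho n ^ 2 / (rho p.1 ^ 3 * rho p.2 ^ 3)))
    (h : ∀ θ : ℝ, 0 < θ → ∀ ε : ℝ, 0 < ε → ∀ᶠ n : ℕ in atTop, ∀ p ∈ antidiagonal n,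
      θ * ((n : ℝ) + 1) ≤ p.1 + 1 → θ * ((n : ℝ) + 1) ≤ p.2 + 1 →
      |f n p| ≤ ε * (invSqrtCoeff p.1 * invSqrtCoeff p.2)) :
    Tendsto (fun n => ∑ p ∈ antidiagonal n, f n p) atTop (nhds 0) := by
  rw [Metric.tendsto_atTop']
  intro ε hε
  set θ := min (1 / 2) (ε / (256 * C)) with hθdef
  have hθ : 0 < θ := by positivity
  have hθ2 : θ ≤ 1 / 2 := min_le_left _ _
  have hθε : 64 * C * θ ≤ ε / 4 := by
    have : θ ≤ ε / (256 * C) := min_le_right _ _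
    rw [le_div_iff₀ (by positivity)] at this
    linarith
  have hθ4 : θ ^ 4 ≤ 1 / 2 := by
    calc θ ^ 4 ≤ (1 / 2) ^ 4 := by gcongr
      _ ≤ _ := by norm_num
  have edge : ∀ n a b : ℕ, a + b = n → (a : ℝ) + 1 ≤ θ ^ 4 * (n + 1) →
      rho n ^ 2 / (rho a ^ 3 * rho b ^ 3) ≤ 8 / rho n * (1 / rho a ^ 3) := by
    intro n a b hab h1
    have ha := rho_pos a
    have hb := rho_pos b
    have hn := rho_pos n
    have hab' : a ≤ b := by
      by_contra hcon
      have : (n : ℝ) ≤ 2 * a := by exact_mod_cast (by omega : n ≤ 2 * a)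
      have : (0 : ℝ) ≤ a := by positivity
      nlinarith
    have h2 : rho n ≤ 2 * rho b :=
      rho_le_two_mul_of_antidiagonal (p := (a, b)) (by simpa using hab) hab'
    have h3 : rho n ^ 3 ≤ (2 * rho b) ^ 3 := by gcongr
    rw [div_mul_div_comm, div_le_div_iff₀ (by positivity) (by positivity)]
    have : rho n ^ 3 * rho a ^ 3 ≤ (2 * rho b) ^ 3 * rho a ^ 3 := by gcongr
    linarith
  obtain ⟨N, hN⟩ := eventually_atTop.1 (h (θ ^ 4) (by positivity) (ε / 2) (by positivity))
  refine ⟨N, fun n hn => ?_⟩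
  rw [Real.dist_eq, sub_zero]
  have hρ := rho_pos n
  have pt : ∀ p ∈ antidiagonal n, |f n p| ≤
      ε / 2 * (invSqrtCoeff p.1 * invSqrtCoeff p.2) +
      (C * (8 / rho n) * (if (p.1 : ℝ) + 1 ≤ θ ^ 4 * (n + 1) then 1 / rho p.1 ^ 3 else 0) +
      C * (8 / rho n) * (if (p.2 : ℝ) + 1 ≤ θ ^ 4 * (n + 1) then 1 / rho p.2 ^ 3 else 0)) := by
    intro p hp
    have hp' := hp
    rw [Finset.HasAntidiagonal.mem_antidiagonal] at hp'
    have b1 := invSqrtCoeff_pos p.1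
    have b2 := invSqrtCoeff_pos p.2
    have r1 := rho_pos p.1
    have r2 := rho_pos p.2
    by_cases c1 : (p.1 : ℝ) + 1 ≤ θ ^ 4 * (n + 1)
    · have e := edge n p.1 p.2 hp' c1
      rw [if_pos c1]
      calc |f n p| ≤ C * (rho n ^ 2 / (rho p.1 ^ 3 * rho p.2 ^ 3)) := hC n p hp
        _ ≤ C * (8 / rho n * (1 / rho p.1 ^ 3)) := by gcongr
        _ = C * (8 / rho n) * (1 / rho p.1 ^ 3) := by ring
        _ ≤ _ := by
          rw [← add_assoc, add_right_comm, add_comm]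
          refine le_add_of_nonneg_right (add_nonneg (by positivity) ?_)
          split_ifs <;> positivity
    · by_cases c2 : (p.2 : ℝ) + 1 ≤ θ ^ 4 * (n + 1)
      · have e := edge n p.2 p.1 (by omega) c2
        rw [if_pos c2]
        calc |f n p| ≤ C * (rho n ^ 2 / (rho p.1 ^ 3 * rho p.2 ^ 3)) := hC n p hp
          _ = C * (rho n ^ 2 / (rho p.2 ^ 3 * rho p.1 ^ 3)) := by rw [mul_comm (rho p.1 ^ 3)]
          _ ≤ C * (8 / rho n * (1 / rho p.2 ^ 3)) := by gcongr
          _ = C * (8 / rho n) * (1 / rho p.2 ^ 3) := by ring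
          _ ≤ _ := by
            rw [← add_assoc, add_comm, if_neg c1]
            refine le_add_of_nonneg_right (add_nonneg (by positivity) (by simp))
      · refine (hN n (le_of_lt hn) p hp (not_le.1 c1).le (not_le.1 c2).le).trans ?_
        refine le_add_of_nonneg_right ?_
        rw [if_neg c1, if_neg c2]
        simp
  calc |∑ p ∈ antidiagonal n, f n p| ≤ ∑ p ∈ antidiagonal n, |f n p| :=
        Finset.abs_sum_le_sum_abs _ _
    _ ≤ _ := Finset.sum_le_sum pt
    _ = ε / 2 * 1 + (C * (8 / rho n) * ∑ p ∈ antidiagonal n,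
          (if (p.1 : ℝ) + 1 ≤ θ ^ 4 * (n + 1) then 1 / rho p.1 ^ 3 else 0) +
        C * (8 / rho n) * ∑ p ∈ antidiagonal n,
          (if (p.2 : ℝ) + 1 ≤ θ ^ 4 * (n + 1) then 1 / rho p.2 ^ 3 else 0)) := by
        rw [Finset.sum_add_distrib, Finset.sum_add_distrib, ← Finset.mul_sum, ← Finset.mul_sum,
          ← Finset.mul_sum, sum_antidiagonal_invSqrtCoeff]
    _ ≤ ε / 2 * 1 + (C * (8 / rho n) * (4 * (θ * rho n)) + C * (8 / rho n) * (4 * (θ * rho n))) := by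
        gcongr
        · exact sum_antidiagonal_fst_inv_rho_cube_filter_le n hθ.le
        · exact sum_antidiagonal_snd_inv_rho_cube_filter_le n hθ.le
    _ = ε / 2 + 64 * C * θ := by field_simp; ring
    _ < ε := by linarith

lemma invSqrtCoeff_le (n : ℕ) : invSqrtCoeff n ≤ 2 / rho n ^ 2 := by
  have hρ := rho_pos n
  rw [le_div_iff₀ (by positivity)]
  refine le_of_pow_le_pow_left₀ (n := 2) (by norm_num) (by norm_num) ?_
  have e : (invSqrtCoeff n * rho n ^ 2) ^ 2 = invSqrtCoeff n ^ 2 * rho n ^ 4 := by ring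
  rw [e, rho_pow_four]
  have h1 := invSqrtCoeff_sq_mul n
  have h2 : 1 / 2 ≤ Real.Wallis.W n := by
    refine le_trans ?_ (Real.Wallis.le_W n)
    have hp := Real.pi_gt_three
    have : (1 : ℝ) / 2 ≤ (2 * n + 1) / (2 * n + 2) := by
      rw [div_le_div_iff₀ (by norm_num) (by positivity)]
      have : (0 : ℝ) ≤ n := by positivity
      linarith
    nlinarith
  have h3 : invSqrtCoeff n ^ 2 * (n + 1) ≤ invSqrtCoeff n ^ 2 * (4 * ((2 * n + 1) *
      Real.Wallis.W n)) := by
    gcongr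
    have : (0 : ℝ) ≤ n := by positivity
    nlinarith
  linarith

lemma exists_delta_four (X Y : ℝ) {ε : ℝ} (hε : 0 < ε) : ∃ δ : ℝ, 0 < δ ∧ ∀ x y r s : ℝ,
    |x - X| ≤ δ → |y - Y| ≤ δ → |r - 1| ≤ δ → |s - 1| ≤ δ → |x * y * (r * s) - X * Y| ≤ ε := by
  have hc : ContinuousAt (fun z : (ℝ × ℝ) × ℝ × ℝ => z.1.1 * z.1.2 * (z.2.1 * z.2.2))
    ((X, Y), (1, 1)) := by fun_prop
  obtain ⟨δ, hδ, h⟩ := Metric.continuousAt_iff.1 hc ε hε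
  refine ⟨δ / 2, by positivity, fun x y r s h1 h2 h3 h4 => ?_⟩
  have := h (x := ((x, y), (r, s))) (by
    simp only [Prod.dist_eq, Real.dist_eq, max_lt_iff]
    refine ⟨⟨?_, ?_⟩, ?_, ?_⟩ <;> linarith)
  rw [Real.dist_eq] at this
  simpa using this.le

/-- Divide both sequences by `invSqrtCoeff`, whose self-convolution is exactly 1. The quotients are
nearly constant in the bulk, and Potter's bound gives the majorant at the ends. Each sequence
contributes a factor √π. -/
lemma tendsto_sum_antidiagonal_mul {l1 l2 : ℕ → ℝ} (h1 : SVSeq l1) (h2 : SVSeq l2) {a b : ℕ → ℝ}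
    {A B : ℝ} (ha : Tendsto (fun n => a n * rho n ^ 2 / l1 n) atTop (nhds A))
    (hb : Tendsto (fun n => b n * rho n ^ 2 / l2 n) atTop (nhds B)) :
    Tendsto (fun n => (∑ p ∈ antidiagonal n, a p.1 * b p.2) / (l1 n * l2 n)) atTop
      (nhds (Real.pi * A * B)) := by
  have hsπ : 0 < Real.sqrt Real.pi := Real.sqrt_pos.2 Real.pi_pos
  have hππ : Real.sqrt Real.pi * Real.sqrt Real.pi = Real.pi := Real.mul_self_sqrt Real.pi_pos.le
  have aux : ∀ {l a : ℕ → ℝ} {A : ℝ}, SVSeq l →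
      Tendsto (fun n => a n * rho n ^ 2 / l n) atTop (nhds A) →
      Tendsto (fun n => a n / (invSqrtCoeff n * l n)) atTop (nhds (A * Real.sqrt Real.pi)) := by
    intro l a A hl h
    have := h.div tendsto_invSqrtCoeff_mul_rho_sq (by positivity)
    rw [div_div_eq_mul_div, div_one] at this
    refine this.congr fun n => ?_
    have := rho_pos n
    have := invSqrtCoeff_pos n
    have := hl.pos n
    simp only [Pi.div_apply]
    field_simp
  have hx := aux h1 ha
  have hy := aux h2 hb
  set X := A * Real.sqrt Real.pi
  set Y := B * Real.sqrt Real.pi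
  set x := fun n => a n / (invSqrtCoeff n * l1 n) with hxdef
  set y := fun n => b n / (invSqrtCoeff n * l2 n) with hydef
  have hXY : X * Y = Real.pi * A * B := by rw [← hππ]; ring
  have ea : ∀ n, a n = x n * invSqrtCoeff n * l1 n := by
    intro n
    have := invSqrtCoeff_pos n
    have := h1.pos n
    simp only [hxdef]; field_simp
  have eb : ∀ n, b n = y n * invSqrtCoeff n * l2 n := by
    intro n
    have := invSqrtCoeff_pos n
    have := h2.pos n
    simp only [hydef]; field_simp
  set f : ℕ → ℕ × ℕ → ℝ := fun n p => invSqrtCoeff p.1 * invSqrtCoeff p.2 *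
    (x p.1 * y p.2 * ((l1 p.1 / l1 n) * (l2 p.2 / l2 n)) - X * Y) with hf
  have main : Tendsto (fun n => ∑ p ∈ antidiagonal n, f n p) atTop (nhds 0) := by
    obtain ⟨C1, hC1, hp1⟩ := h1.potter
    obtain ⟨C2, hC2, hp2⟩ := h2.potter
    obtain ⟨Cx, hCx, hbx⟩ := exists_abs_le_of_tendsto hx
    obtain ⟨Cy, hCy, hby⟩ := exists_abs_le_of_tendsto hy
    refine tendsto_sum_antidiagonal_zero (C := 4 * (Cx * Cy * (C1 * C2) + |X * Y|))
      (by positivity) ?_ ?_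
    · intro n p hp
      rw [Finset.HasAntidiagonal.mem_antidiagonal] at hp
      have rn := rho_pos n
      have r1 := rho_pos p.1
      have r2 := rho_pos p.2
      have q1 := h1.pos p.1
      have q2 := h2.pos p.2
      have q1n := h1.pos n
      have q2n := h2.pos n
      have b1 := invSqrtCoeff_le p.1
      have b2 := invSqrtCoeff_le p.2
      have b1' := invSqrtCoeff_pos p.1
      have b2' := invSqrtCoeff_pos p.2
      have t1 : l1 p.1 / l1 n ≤ C1 * (rho n / rho p.1) := by
        have := hp1 p.1 n (by omega)
        rw [div_le_iff₀ q1n, ← mul_div_assoc, div_mul_eq_mul_div, le_div_iff₀ r1]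
        linarith
      have t2 : l2 p.2 / l2 n ≤ C2 * (rho n / rho p.2) := by
        have := hp2 p.2 n (by omega)
        rw [div_le_iff₀ q2n, ← mul_div_assoc, div_mul_eq_mul_div, le_div_iff₀ r2]
        linarith
      have m1 : 1 ≤ rho n / rho p.1 := by
        rw [le_div_iff₀ r1, one_mul]; exact rho_mono (by omega)
      have m2 : 1 ≤ rho n / rho p.2 := by
        rw [le_div_iff₀ r2, one_mul]; exact rho_mono (by omega)
      have u1 : |x p.1 * y p.2 * ((l1 p.1 / l1 n) * (l2 p.2 / l2 n)) - X * Y| ≤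
          (Cx * Cy * (C1 * C2) + |X * Y|) * ((rho n / rho p.1) * (rho n / rho p.2)) := by
        refine (abs_sub _ _).trans ?_
        rw [add_mul]
        refine add_le_add ?_ (le_mul_of_one_le_right (abs_nonneg _) (one_le_mul_of_one_le_of_one_le m1 m2))
        rw [abs_mul, abs_mul, abs_of_pos (by positivity : 0 < l1 p.1 / l1 n * (l2 p.2 / l2 n))]
        calc |x p.1| * |y p.2| * (l1 p.1 / l1 n * (l2 p.2 / l2 n)) ≤
            Cx * Cy * ((C1 * (rho n / rho p.1)) * (C2 * (rho n / rho p.2))) := by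
              gcongr
              · exact hbx _
              · exact hby _
          _ = _ := by ring
      rw [hf, abs_mul, abs_of_pos (by positivity : 0 < invSqrtCoeff p.1 * invSqrtCoeff p.2)]
      calc _ ≤ (2 / rho p.1 ^ 2) * (2 / rho p.2 ^ 2) *
            ((Cx * Cy * (C1 * C2) + |X * Y|) * ((rho n / rho p.1) * (rho n / rho p.2))) := by
            gcongr
        _ = _ := by field_simp; ring
    · intro θ hθ ε hε
      obtain ⟨δ, hδ, hd⟩ := exists_delta_four X Y hε
      have evx : ∀ᶠ n in atTop, |x n - X| ≤ δ :=
        (Metric.tendsto_nhds.1 hx δ hδ).mono fun n hn => by rw [Real.dist_eq] at hn; exact hn.le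
      have evy : ∀ᶠ n in atTop, |y n - Y| ≤ δ :=
        (Metric.tendsto_nhds.1 hy δ hδ).mono fun n hn => by rw [Real.dist_eq] at hn; exact hn.le
      filter_upwards [SVSeq.eventually_of_le hθ evx, SVSeq.eventually_of_le hθ evy,
        h1.unif' hθ hδ, h2.unif' hθ hδ] with n e1 e2 e3 e4 p hp c1 c2
      rw [Finset.HasAntidiagonal.mem_antidiagonal] at hp
      have b1' := invSqrtCoeff_pos p.1
      have b2' := invSqrtCoeff_pos p.2
      rw [hf, abs_mul, abs_of_pos (by positivity : 0 < invSqrtCoeff p.1 * invSqrtCoeff p.2),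
        mul_comm ε]
      gcongr
      exact hd _ _ _ _ (e1 _ c1) (e2 _ c2) (e3 _ (by omega) c1) (e4 _ (by omega) c2)
  have e : ∀ n, (∑ p ∈ antidiagonal n, a p.1 * b p.2) / (l1 n * l2 n) =
      ∑ p ∈ antidiagonal n, f n p + X * Y := by
    intro n
    have := h1.pos n
    have := h2.pos n
    have e1 : X * Y = ∑ p ∈ antidiagonal n, invSqrtCoeff p.1 * invSqrtCoeff p.2 * (X * Y) := by
      rw [← Finset.sum_mul, sum_antidiagonal_invSqrtCoeff, one_mul]
    conv_rhs => rw [e1]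
    rw [← Finset.sum_add_distrib, Finset.sum_div]
    refine Finset.sum_congr rfl fun p _ => ?_
    rw [hf, ea p.1, eb p.2]
    field_simp
    ring
  rw [← hXY]
  simp_rw [e]
  simpa using main.add_const (X * Y)

/-! ### Tails of sequences of index -3/2. -/

lemma tendsto_rho_succ_div : Tendsto (fun n => rho (n + 1) / rho n) atTop (nhds 1) := by
  have h1 : Tendsto (fun n => 1 + 1 / rho n ^ 4) atTop (nhds (1 + 0)) :=
    tendsto_const_nhds.add (tendsto_const_nhds.div_atTop
      ((tendsto_pow_atTop (by norm_num)).comp tendsto_rho))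
  rw [add_zero] at h1
  refine tendsto_of_tendsto_of_tendsto_of_le_of_le tendsto_const_nhds h1 (fun n => ?_) fun n => ?_
  · have := rho_pos n
    simp only
    rw [le_div_iff₀ this, one_mul]
    exact rho_mono n.le_succ
  · have h := rho_pos n
    have h' : 0 < 1 / rho n ^ 4 := by positivity
    rw [div_le_iff₀ h]
    refine rho_le_of_le (by positivity) ?_
    rw [mul_pow, rho_pow_four]
    rw [rho_pow_four] at h'
    have e : (1 + 1 / ((n : ℝ) + 1)) * (n + 1) = n + 1 + 1 := by field_simp
    push_cast
    rw [← e]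
    gcongr
    exact le_self_pow₀ (by linarith) (by norm_num)

lemma SVSeq.tendsto_succ_div {l : ℕ → ℝ} (h : SVSeq l) :
    Tendsto (fun n => l (n + 1) / l n) atTop (nhds 1) := by
  rw [Metric.tendsto_nhds]
  intro ε hε
  have h1 := h.inv.unif' (η := 1 / 2) (by norm_num) (ε := ε / 2) (by positivity)
  filter_upwards [(tendsto_add_atTop_nat 1).eventually h1] with n hn
  have := hn n n.le_succ (by push_cast; have : (0 : ℝ) ≤ n := by positivity
                             linarith)
  rw [inv_div_inv] at this
  rw [Real.dist_eq]
  linarith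

/-- The differences of `1 / sqrt (n + 1)`. -/
noncomputable def invSqrtDiff (n : ℕ) : ℝ := 1 / rho n ^ 2 - 1 / rho (n + 1) ^ 2

lemma invSqrtDiff_eq (n : ℕ) : invSqrtDiff n =
    1 / (rho n ^ 2 * rho (n + 1) ^ 2 * (rho n ^ 2 + rho (n + 1) ^ 2)) := by
  have h1 := rho_pos n
  have h2 := rho_pos (n + 1)
  have h : rho (n + 1) ^ 4 - rho n ^ 4 = 1 := by
    rw [rho_pow_four, rho_pow_four]; push_cast; ring
  rw [invSqrtDiff]
  field_simp
  linear_combination h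

lemma invSqrtDiff_pos (n : ℕ) : 0 < invSqrtDiff n := by
  have h1 := rho_pos n
  have h2 := rho_pos (n + 1)
  rw [invSqrtDiff_eq]
  positivity

lemma invSqrtDiff_le (n : ℕ) : invSqrtDiff n ≤ 1 / rho n ^ 6 := by
  have h1 := rho_pos n
  have h2 := rho_mono n.le_succ
  rw [invSqrtDiff_eq]
  gcongr
  calc rho n ^ 6 ≤ rho n ^ 2 * rho n ^ 2 * (rho n ^ 2 + rho n ^ 2) := by
        have : 0 < rho n ^ 6 := by positivity
        ring_nf; linarith
    _ ≤ _ := by gcongr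

lemma tendsto_invSqrtDiff : Tendsto (fun n => invSqrtDiff n * rho (n + 1) ^ 6) atTop
    (nhds (1 / 2)) := by
  have h := ((tendsto_rho_succ_div.pow 4).div ((tendsto_rho_succ_div.pow 2).const_add 1)
    (by norm_num))
  norm_num at h
  refine h.congr fun n => ?_
  have h1 := rho_pos n
  have h2 := rho_pos (n + 1)
  rw [invSqrtDiff_eq]
  simp only [Pi.div_apply]
  field_simp

/-- A term of index -3/2 multiplied by a Potter factor has index -5/4. The telescoping majorant
makes its far tail summable with an explicit rate. -/
lemma inv_rho_pow_five_le (n : ℕ) : 1 / rho n ^ 5 ≤ 64 * (1 / rho n - 1 / rho (n + 1)) := by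
  have h1 := rho_pos n
  have h2 := rho_pos (n + 1)
  have h3 := rho_mono n.le_succ
  have h4 := rho_succ_le n
  have h : rho (n + 1) ^ 4 - rho n ^ 4 = 1 := by
    rw [rho_pow_four, rho_pow_four]; push_cast; ring
  set x := rho n
  set y := rho (n + 1)
  have key : 1 ≤ (y - x) * (4 * y ^ 3) := by
    have e : 1 = (y - x) * (y ^ 3 + y ^ 2 * x + y * x ^ 2 + x ^ 3) := by
      linear_combination -h
    rw [e]
    refine mul_le_mul_of_nonneg_left ?_ (sub_nonneg.2 h3)
    have a1 : y ^ 2 * x ≤ y ^ 2 * y := by gcongr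
    have a2 : y * x ^ 2 ≤ y * y ^ 2 := by gcongr
    have a3 : x ^ 3 ≤ y ^ 3 := by gcongr
    nlinarith
  have e : 64 * (1 / x - 1 / y) = 64 * (y - x) / (x * y) := by field_simp
  rw [e, div_le_div_iff₀ (by positivity) (by positivity)]
  have hy4 : y ^ 4 ≤ (2 * x) ^ 4 := by gcongr
  calc 1 * (x * y) ≤ (y - x) * (4 * y ^ 3) * (x * y) := by gcongr
    _ = (y - x) * (4 * x) * y ^ 4 := by ring
    _ ≤ (y - x) * (4 * x) * (2 * x) ^ 4 := by
        gcongr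
    _ = _ := by ring

lemma sum_Ico_sub_succ (f : ℕ → ℝ) {n m : ℕ} (h : n ≤ m) :
    ∑ k ∈ Finset.Ico n m, (f k - f (k + 1)) = f n - f m := by
  induction m, h using Nat.le_induction with
  | base => simp
  | succ m hm ih => rw [Finset.sum_Ico_succ_top hm, ih]; ring

/-- The tail `∑_{k > n} q k` of a summable sequence of total mass one. -/
noncomputable def tail (q : ℕ → ℝ) (n : ℕ) : ℝ := 1 - ∑ k ∈ Finset.range (n + 1), q k

/-- Compare q(k + 1)/l(n) with 2c times the increments of 1/√k, which telescope. Slow variation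
handles k up to order n/θ⁴, and Potter's bound handles the rest. -/
lemma tendsto_tail {l : ℕ → ℝ} (hl : SVSeq l) {q : ℕ → ℝ} (hs : HasSum q 1) {c : ℝ}
    (hq : Tendsto (fun n => q n * rho n ^ 6 / l n) atTop (nhds c)) :
    Tendsto (fun n => tail q n * rho n ^ 2 / l n) atTop (nhds (2 * c)) := by
  set z := fun k => q (k + 1) / (invSqrtDiff k * l (k + 1)) with hzdef
  have hz : Tendsto z atTop (nhds (2 * c)) := by
    have h := ((tendsto_add_atTop_iff_nat 1).2 hq).div tendsto_invSqrtDiff (by norm_num)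
    rw [div_div_eq_mul_div, div_one, mul_comm] at h
    refine h.congr fun n => ?_
    have := rho_pos (n + 1)
    have := hl.pos (n + 1)
    have := invSqrtDiff_pos n
    simp only [Pi.div_apply, hzdef]
    field_simp
  have eq : ∀ k, q (k + 1) = invSqrtDiff k * (z k * l (k + 1)) := by
    intro k
    have := hl.pos (k + 1)
    have := invSqrtDiff_pos k
    simp only [hzdef]
    field_simp
  obtain ⟨Cz, hCz, hbz⟩ := exists_abs_le_of_tendsto hz
  -- Potter's bound controls a smaller index by a larger one. Here l(k + 1) must be bounded by l(n)
  -- with k ≥ n, so it is applied to 1/l.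
  obtain ⟨C, hC1, hp⟩ := hl.inv.potter
  have hC : 0 < C := by linarith
  set K := Cz * (2 * C) + |2 * c| with hK
  have hK0 : 0 < K := by positivity
  rw [Metric.tendsto_nhds]
  intro ε hε
  set θ := min 1 (ε / (256 * K)) with hθdef
  have hθ : 0 < θ := by positivity
  have hθε : 64 * K * θ ≤ ε / 4 := by
    have : θ ≤ ε / (256 * K) := min_le_right _ _
    rw [le_div_iff₀ (by positivity)] at this
    linarith
  obtain ⟨δ, hδ, hd⟩ := exists_delta_four (2 * c) 1 (by positivity : 0 < ε / 4)
  have evz : ∀ᶠ k in atTop, |z k - 2 * c| ≤ δ :=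
    (Metric.tendsto_nhds.1 hz δ hδ).mono fun n hn => by rw [Real.dist_eq] at hn; exact hn.le
  have evl := (tendsto_add_atTop_nat 1).eventually
    (hl.inv.unif' (η := θ ^ 4 / 2) (by positivity) (ε := δ) hδ)
  obtain ⟨N, hN⟩ := eventually_atTop.1 (evz.and evl)
  filter_upwards [eventually_ge_atTop N] with n hn
  have rn := rho_pos n
  have ln := hl.pos n
  -- The truncation makes g constant over the near range, so the telescoping sum of its decrements
  -- counts only the far terms and is at most θ / rho n.
  set g : ℕ → ℝ := fun k => min (1 / rho k) (θ / rho n) with hg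
  have pt : ∀ k, n ≤ k → |q (k + 1) / l n - 2 * c * invSqrtDiff k| ≤
      ε / 4 * invSqrtDiff k + 64 * K / rho n * (g k - g (k + 1)) := by
    intro k hk
    obtain ⟨h1, h2⟩ := hN k (hn.trans hk)
    have rk := rho_pos k
    have rk1 := rho_pos (k + 1)
    have lk := hl.pos (k + 1)
    have tk := invSqrtDiff_pos k
    have rkm := rho_mono k.le_succ
    have e : q (k + 1) / l n - 2 * c * invSqrtDiff k =
        invSqrtDiff k * (z k * (l (k + 1) / l n) - 2 * c) := by
      rw [eq k]; ring
    rw [e, abs_mul, abs_of_pos tk]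
    have gmono : 0 ≤ g k - g (k + 1) := by
      rw [sub_nonneg]
      exact min_le_min_right _ (by gcongr)
    by_cases c1 : θ * rho k ≤ rho n
    · have h3 := h2 n (by omega) (by
        have h4 : (θ * rho k) ^ 4 ≤ rho n ^ 4 := by gcongr
        rw [mul_pow, rho_pow_four, rho_pow_four] at h4
        have : 0 ≤ θ ^ 4 * k := by positivity
        push_cast
        linarith)
      rw [inv_div_inv] at h3
      have h5 := hd (z k) 1 (l (k + 1) / l n) 1 h1 (by simpa using hδ.le) h3 (by simpa using hδ.le)
      simp only [mul_one] at h5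
      calc _ ≤ invSqrtDiff k * (ε / 4) := by gcongr
        _ = ε / 4 * invSqrtDiff k := mul_comm _ _
        _ ≤ _ := le_add_of_nonneg_right (by positivity)
    · rw [not_le] at c1
      have hlt : ∀ j, k ≤ j → g j = 1 / rho j := by
        intro j hj
        refine min_eq_left ?_
        have := rho_pos j
        have := rho_mono hj
        rw [div_le_div_iff₀ (by positivity) rn]
        nlinarith
      have hpk : l (k + 1) / l n ≤ 2 * C * (rho k / rho n) := by
        have h3 := hp n (k + 1) (by omega)
        have h4 := rho_succ_le k
        rw [← div_eq_inv_mul, ← div_eq_mul_inv, ← mul_div_assoc, div_le_div_iff₀ ln lk] at h3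
        rw [div_le_iff₀ ln, ← mul_div_assoc, div_mul_eq_mul_div, le_div_iff₀ rn]
        calc l (k + 1) * rho n ≤ C * rho (k + 1) * l n := by linarith
          _ ≤ C * (2 * rho k) * l n := by gcongr
          _ = _ := by ring
      have m1 : 1 ≤ rho k / rho n := by
        rw [le_div_iff₀ rn, one_mul]; exact rho_mono hk
      have b : |z k * (l (k + 1) / l n) - 2 * c| ≤ K * (rho k / rho n) := by
        refine (abs_sub _ _).trans ?_
        rw [hK, add_mul]
        refine add_le_add ?_ (le_mul_of_one_le_right (abs_nonneg _) m1)
        rw [abs_mul, abs_of_pos (by positivity : 0 < l (k + 1) / l n), mul_assoc]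
        gcongr
        exact hbz k
      calc _ ≤ 1 / rho k ^ 6 * (K * (rho k / rho n)) := by
            gcongr
            exact invSqrtDiff_le k
        _ = K / rho n * (1 / rho k ^ 5) := by field_simp
        _ ≤ K / rho n * (64 * (1 / rho k - 1 / rho (k + 1))) := by
            gcongr
            exact inv_rho_pow_five_le k
        _ = 64 * K / rho n * (g k - g (k + 1)) := by
            rw [hlt k le_rfl, hlt (k + 1) (by omega)]; ring
        _ ≤ _ := le_add_of_nonneg_left (by positivity)
  have hM : ∀ M, n ≤ M → |(∑ k ∈ Finset.Ico n M, q (k + 1)) / l n -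
      2 * c * (1 / rho n ^ 2 - 1 / rho M ^ 2)| ≤ (ε / 4 + 64 * K * θ) / rho n ^ 2 := by
    intro M hM
    have rM := rho_pos M
    rw [← sum_Ico_sub_succ (fun k => 1 / rho k ^ 2) hM, Finset.sum_div, Finset.mul_sum,
      ← Finset.sum_sub_distrib]
    calc _ ≤ ∑ k ∈ Finset.Ico n M, |q (k + 1) / l n - 2 * c * invSqrtDiff k| :=
          Finset.abs_sum_le_sum_abs _ _
      _ ≤ ∑ k ∈ Finset.Ico n M,
          (ε / 4 * invSqrtDiff k + 64 * K / rho n * (g k - g (k + 1))) :=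
          Finset.sum_le_sum fun k hk => pt k (Finset.mem_Ico.1 hk).1
      _ = ε / 4 * (1 / rho n ^ 2 - 1 / rho M ^ 2) + 64 * K / rho n * (g n - g M) := by
          rw [Finset.sum_add_distrib, ← Finset.mul_sum, ← Finset.mul_sum, sum_Ico_sub_succ g hM]
          congr 2
          exact sum_Ico_sub_succ (fun k => 1 / rho k ^ 2) hM
      _ ≤ ε / 4 * (1 / rho n ^ 2) + 64 * K / rho n * (θ / rho n) := by
          have : 0 ≤ g M := le_min (by positivity) (by positivity)
          have : g n ≤ θ / rho n := min_le_right _ _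
          gcongr
          · have : 0 < 1 / rho M ^ 2 := by positivity
            linarith
          · linarith
      _ = _ := by field_simp
  have lim : Tendsto (fun M => |(∑ k ∈ Finset.Ico n M, q (k + 1)) / l n -
      2 * c * (1 / rho n ^ 2 - 1 / rho M ^ 2)|) atTop
      (nhds |tail q n / l n - 2 * c * (1 / rho n ^ 2 - 0)|) := by
    have t1 : Tendsto (fun M => 1 / rho M ^ 2) atTop (nhds 0) :=
      tendsto_const_nhds.div_atTop ((tendsto_pow_atTop (by norm_num)).comp tendsto_rho)
    have t2 : Tendsto (fun M => ∑ k ∈ Finset.Ico n M, q (k + 1)) atTop (nhds (tail q n)) := by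
      have t3 := ((tendsto_add_atTop_iff_nat 1).2 hs.tendsto_sum_nat).sub_const
        (∑ k ∈ Finset.range (n + 1), q k)
      refine t3.congr' ?_
      filter_upwards [eventually_ge_atTop n] with M hM
      rw [← Finset.sum_Ico_eq_sub _ (by omega), Finset.sum_Ico_add' q n M 1]
    exact ((t2.div_const _).sub ((tendsto_const_nhds.sub t1).const_mul _)).abs
  have fin := le_of_tendsto lim (eventually_atTop.2 ⟨n, hM⟩)
  rw [sub_zero] at fin
  rw [Real.dist_eq]
  have e : tail q n * rho n ^ 2 / l n - 2 * c =
      (tail q n / l n - 2 * c * (1 / rho n ^ 2)) * rho n ^ 2 := by field_simp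
  rw [e, abs_mul, abs_of_pos (by positivity : 0 < rho n ^ 2)]
  rw [le_div_iff₀ (by positivity)] at fin
  linarith

/-! ### Renewal sequences and their power series identities. -/

lemma mk_tail (q : ℕ → ℝ) :
    PowerSeries.mk (tail q) = (1 - PowerSeries.mk q) * PowerSeries.mk (1 : ℕ → ℝ) := by
  have h2 : (1 - PowerSeries.X) * PowerSeries.mk (1 : ℕ → ℝ) = 1 := by
    rw [mul_comm]; exact PowerSeries.mk_one_mul_one_sub_eq_one ℝ
  have e : (1 - PowerSeries.X) * PowerSeries.mk (tail q) = 1 - PowerSeries.mk q := by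
    ext n
    rw [sub_mul, one_mul]
    cases n with
    | zero => simp [tail]
    | succ n =>
      rw [map_sub, PowerSeries.coeff_succ_X_mul]
      simp only [PowerSeries.coeff_mk, map_sub, PowerSeries.coeff_one, tail]
      rw [Finset.sum_range_succ _ (n + 1)]
      simp
  calc _ = (1 - PowerSeries.X) * PowerSeries.mk (1 : ℕ → ℝ) * PowerSeries.mk (tail q) := by
        rw [h2, one_mul]
    _ = (1 - PowerSeries.X) * PowerSeries.mk (tail q) * PowerSeries.mk (1 : ℕ → ℝ) := by ring
    _ = _ := by rw [e]

/-- `u` is the renewal sequence of the probability sequence `q` on the positive integers. -/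
structure IsRenewal (q u : ℕ → ℝ) : Prop where
  zero : q 0 = 0
  nonneg : ∀ n, 0 ≤ q n
  hasSum : HasSum q 1
  init : u 0 = 1
  rec_succ : ∀ n, u (n + 1) = ∑ p ∈ antidiagonal n, q (p.1 + 1) * u p.2

namespace IsRenewal

variable {q u : ℕ → ℝ}

lemma u_nonneg (h : IsRenewal q u) (n : ℕ) : 0 ≤ u n := by
  induction n using Nat.strong_induction_on with
  | _ n ih =>
    cases n with
    | zero => rw [h.init]; exact zero_le_one
    | succ n =>
      rw [h.rec_succ]
      refine Finset.sum_nonneg fun p hp => mul_nonneg (h.nonneg _) (ih _ ?_)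
      rw [Finset.HasAntidiagonal.mem_antidiagonal] at hp
      omega

lemma tail_antitone (h : IsRenewal q u) {m n : ℕ} (hmn : m ≤ n) : tail q n ≤ tail q m := by
  refine sub_le_sub_left ?_ _
  refine Finset.sum_le_sum_of_subset_of_nonneg (fun i hi => ?_) fun i _ _ => h.nonneg i
  rw [Finset.mem_range] at hi ⊢
  omega

lemma tail_pos (h : IsRenewal q u) (hq : ∀ᶠ n in atTop, 0 < q n) (n : ℕ) : 0 < tail q n := by
  obtain ⟨N, hN⟩ := eventually_atTop.1 hq
  set m := max N (n + 1)
  have h1 : ∑ k ∈ Finset.range (m + 1), q k ≤ 1 :=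
    sum_le_hasSum _ (fun i _ => h.nonneg i) h.hasSum
  rw [Finset.sum_range_succ] at h1
  have h2 : ∑ k ∈ Finset.range (n + 1), q k ≤ ∑ k ∈ Finset.range m, q k := by
    refine Finset.sum_le_sum_of_subset_of_nonneg (fun i hi => ?_) fun i _ _ => h.nonneg i
    rw [Finset.mem_range] at hi ⊢
    omega
  have := hN m (le_max_left _ _)
  rw [tail]
  linarith

lemma mk_mul (h : IsRenewal q u) : PowerSeries.mk u * (1 - PowerSeries.mk q) = 1 := by
  have e : PowerSeries.mk u = 1 + PowerSeries.mk q * PowerSeries.mk u := by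
    ext n
    cases n with
    | zero => simp [h.init, h.zero]
    | succ n =>
      rw [map_add, PowerSeries.coeff_mul, PowerSeries.coeff_mk, PowerSeries.coeff_one,
        Finset.Nat.antidiagonal_succ, Finset.sum_cons, Finset.sum_map, h.rec_succ]
      simp [h.zero]
  rw [mul_sub, mul_one, mul_comm _ (PowerSeries.mk q)]
  nth_rewrite 1 [e]
  ring

lemma coeff_mul_mk_one (f : PowerSeries ℝ) (n : ℕ) :
    PowerSeries.coeff n (f * PowerSeries.mk (1 : ℕ → ℝ)) =
      ∑ k ∈ Finset.range (n + 1), PowerSeries.coeff k f := by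
  rw [PowerSeries.coeff_mul, Finset.Nat.sum_antidiagonal_eq_sum_range_succ_mk]
  simp

/-- In T = (1 - Q)/(1 - X) the factor 1 - Q is cancelled by U. -/
lemma mk_mul_mk_tail (h : IsRenewal q u) :
    PowerSeries.mk u * PowerSeries.mk (tail q) = PowerSeries.mk (1 : ℕ → ℝ) := by
  rw [mk_tail, ← mul_assoc, h.mk_mul, one_mul]

lemma sum_u_mul_tail (h : IsRenewal q u) (n : ℕ) :
    ∑ p ∈ antidiagonal n, u p.1 * tail q p.2 = 1 := by
  have := congrArg (PowerSeries.coeff n) h.mk_mul_mk_tail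
  rw [PowerSeries.coeff_mul] at this
  simpa using this

/-- The identity TU² = U/(1 - X), to be set against U' = Q'U². -/
lemma sum_tail_mul_sq (h : IsRenewal q u) (n : ℕ) :
    ∑ p ∈ antidiagonal n, tail q p.1 * (∑ r ∈ antidiagonal p.2, u r.1 * u r.2) =
      ∑ k ∈ Finset.range (n + 1), u k := by
  have e : PowerSeries.mk (tail q) * (PowerSeries.mk u * PowerSeries.mk u) =
      PowerSeries.mk u * PowerSeries.mk (1 : ℕ → ℝ) := by
    rw [← h.mk_mul_mk_tail]; ring
  have := congrArg (PowerSeries.coeff n) e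
  rw [coeff_mul_mk_one, PowerSeries.coeff_mul] at this
  simpa [PowerSeries.coeff_mul] using this

/-- Differentiating U(1 - Q) = 1 and multiplying by U gives U' = Q'U². The weight i + 1 raises the
index of q from -3/2 to -1/2, that of the tails. -/
lemma succ_mul_u_succ (h : IsRenewal q u) (n : ℕ) :
    ((n : ℝ) + 1) * u (n + 1) = ∑ p ∈ antidiagonal n,
      (((p.1 : ℝ) + 1) * q (p.1 + 1)) * (∑ r ∈ antidiagonal p.2, u r.1 * u r.2) := by
  have e := congrArg (PowerSeries.derivative ℝ) h.mk_mul
  rw [Derivation.leibniz, PowerSeries.derivative_one, map_sub, PowerSeries.derivative_one,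
    smul_eq_mul, smul_eq_mul] at e
  have e2 : PowerSeries.derivative ℝ (PowerSeries.mk u) =
      PowerSeries.derivative ℝ (PowerSeries.mk q) * (PowerSeries.mk u * PowerSeries.mk u) := by
    linear_combination PowerSeries.mk u * e - PowerSeries.derivative ℝ (PowerSeries.mk u) * h.mk_mul
  have := congrArg (PowerSeries.coeff n) e2
  rw [PowerSeries.coeff_mul, PowerSeries.coeff_derivative] at this
  simp only [PowerSeries.coeff_mk, PowerSeries.coeff_derivative, PowerSeries.coeff_mul] at this
  rw [mul_comm, this]
  refine Finset.sum_congr rfl fun p _ => ?_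
  ring

/-- The identity U(TB) = B/(1 - X) with B = (1 - X)^(-1/2). Multiplying T by B turns index -1/2 into
index 0, so the inner factor becomes slowly varying. -/
lemma sum_u_mul_conv (h : IsRenewal q u) (n : ℕ) :
    ∑ p ∈ antidiagonal n, u p.1 * (∑ r ∈ antidiagonal p.2, tail q r.1 * invSqrtCoeff r.2) =
      (2 * n + 1) * invSqrtCoeff n := by
  have e : PowerSeries.mk u * (PowerSeries.mk (tail q) * PowerSeries.mk invSqrtCoeff) =
      PowerSeries.mk invSqrtCoeff * PowerSeries.mk (1 : ℕ → ℝ) := by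
    rw [← h.mk_mul_mk_tail]; ring
  have := congrArg (PowerSeries.coeff n) e
  rw [coeff_mul_mk_one, PowerSeries.coeff_mul] at this
  simpa [PowerSeries.coeff_mul, sum_invSqrtCoeff] using this

/-- The tails decrease, so each one in `sum_u_mul_tail` is at least `tail q n`. -/
lemma sum_u_le (h : IsRenewal q u) (hq : ∀ᶠ n in atTop, 0 < q n) (n : ℕ) :
    ∑ k ∈ Finset.range (n + 1), u k ≤ 1 / tail q n := by
  rw [le_div_iff₀ (h.tail_pos hq n), ← h.sum_u_mul_tail n, Finset.sum_mul,
    Finset.Nat.sum_antidiagonal_eq_sum_range_succ_mk]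
  refine Finset.sum_le_sum fun k _ => ?_
  exact mul_le_mul_of_nonneg_left (h.tail_antitone (Nat.sub_le _ _)) (h.u_nonneg k)

lemma sum_sq_nonneg (h : IsRenewal q u) (n : ℕ) : 0 ≤ ∑ r ∈ antidiagonal n, u r.1 * u r.2 :=
  Finset.sum_nonneg fun _ _ => mul_nonneg (h.u_nonneg _) (h.u_nonneg _)

lemma sum_sq_le (h : IsRenewal q u) (hq : ∀ᶠ n in atTop, 0 < q n) (n : ℕ) :
    ∑ p ∈ antidiagonal n, (∑ r ∈ antidiagonal p.2, u r.1 * u r.2) ≤ (1 / tail q n) ^ 2 := by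
  have h0 := h.tail_pos hq n
  have h1 : (∑ p ∈ antidiagonal n, (∑ r ∈ antidiagonal p.2, u r.1 * u r.2)) * tail q n ≤
      1 / tail q n := by
    refine le_trans ?_ (h.sum_u_le hq n)
    rw [← h.sum_tail_mul_sq, Finset.sum_mul]
    refine Finset.sum_le_sum fun p hp => ?_
    rw [mul_comm]
    refine mul_le_mul_of_nonneg_right (h.tail_antitone ?_) (h.sum_sq_nonneg _)
    rw [Finset.HasAntidiagonal.mem_antidiagonal] at hp
    omega
  rw [← le_div_iff₀ h0] at h1
  calc _ ≤ _ := h1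
    _ = _ := by field_simp

end IsRenewal

/-! ### The local renewal theorem. -/

lemma SVSeq.exists_le_div {l : ℕ → ℝ} (h : SVSeq l) :
    ∃ C : ℝ, 0 < C ∧ ∀ m n : ℕ, m ≤ n → l m ≤ C * (rho n / rho m) * l n := by
  obtain ⟨C, hC1, hp⟩ := h.potter
  refine ⟨C, by linarith, fun m n hmn => ?_⟩
  have := hp m n hmn
  have rm := rho_pos m
  rw [← mul_div_assoc, div_mul_eq_mul_div, le_div_iff₀ rm]
  linarith

lemma SVSeq.exists_le_of_rho_le {l : ℕ → ℝ} (h : SVSeq l) :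
    ∃ C : ℝ, 0 < C ∧ ∀ m n : ℕ, m ≤ n → rho n ≤ 2 * rho m → l m ≤ C * l n := by
  obtain ⟨C, hC, hp⟩ := h.exists_le_div
  refine ⟨C * 2, by positivity, fun m n hmn hr => (hp m n hmn).trans ?_⟩
  have rm := rho_pos m
  have := h.pos n
  gcongr
  rw [div_le_iff₀ rm]
  exact hr

lemma SVSeq.exists_inv_mul_rho_sq_le {l : ℕ → ℝ} (h : SVSeq l) :
    ∃ D : ℝ, 0 < D ∧ ∀ m n : ℕ, m ≤ n → rho n ≤ 2 * rho m →
      1 / (l m * rho m ^ 2) ≤ D / (l n * rho n ^ 2) := by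
  obtain ⟨C, hC, hp⟩ := h.inv.exists_le_of_rho_le
  refine ⟨C * 4, by positivity, fun m n hmn hr => ?_⟩
  have rm := rho_pos m
  have rn := rho_pos n
  have lm := h.pos m
  have ln := h.pos n
  have h1 := hp m n hmn hr
  have h2 : 1 / rho m ^ 2 ≤ 4 / rho n ^ 2 := by
    rw [div_le_div_iff₀ (by positivity) (by positivity)]
    nlinarith
  calc 1 / (l m * rho m ^ 2) = (l m)⁻¹ * (1 / rho m ^ 2) := by field_simp
    _ ≤ (C * (l n)⁻¹) * (4 / rho n ^ 2) := by gcongr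
    _ = _ := by field_simp

lemma rho_le_of_add_eq {n a b : ℕ} {θ : ℝ} (hθ0 : 0 ≤ θ) (hθ : θ ≤ 1 / 2) (hab : a + b = n)
    (h : (b : ℝ) + 1 ≤ θ ^ 4 * (n + 1)) : rho n ≤ 2 * rho a := by
  have hθ4 : θ ^ 4 ≤ 1 / 2 := by
    calc θ ^ 4 ≤ (1 / 2) ^ 4 := by gcongr
      _ ≤ _ := by norm_num
  refine rho_half_le ?_
  have h1 : (n : ℝ) = a + b := by exact_mod_cast hab.symm
  have : (0 : ℝ) ≤ n := by positivity
  have : θ ^ 4 * ((n : ℝ) + 1) ≤ 1 / 2 * (n + 1) := by gcongr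
  linarith

namespace IsRenewal

variable {q u l : ℕ → ℝ} {c : ℝ}

lemma eventually_pos (hl : SVSeq l) (hc : 0 < c)
    (hq : Tendsto (fun n => q n * rho n ^ 6 / l n) atTop (nhds c)) : ∀ᶠ n in atTop, 0 < q n := by
  filter_upwards [hq.eventually (lt_mem_nhds hc)] with n hn
  have := rho_pos n
  have := hl.pos n
  by_contra hcon
  refine absurd hn (not_lt.2 ?_)
  exact div_nonpos_of_nonpos_of_nonneg
    (mul_nonpos_of_nonpos_of_nonneg (not_lt.1 hcon) (by positivity)) this.le

lemma exists_inv_tail_le (h : IsRenewal q u) (hl : SVSeq l) (hc : 0 < c)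
    (hq : Tendsto (fun n => q n * rho n ^ 6 / l n) atTop (nhds c)) :
    ∃ C : ℝ, 0 < C ∧ ∀ n, 1 / tail q n ≤ C * (rho n ^ 2 / l n) := by
  obtain ⟨C, hC, hb⟩ := exists_abs_le_of_tendsto
    ((tendsto_tail hl h.hasSum hq).inv₀ (by positivity))
  refine ⟨C, hC, fun n => ?_⟩
  have h1 := (le_abs_self _).trans (hb n)
  have := rho_pos n
  have := hl.pos n
  have := h.tail_pos (eventually_pos hl hc hq) n
  rw [inv_le_iff_one_le_mul₀ (by positivity)] at h1
  rw [div_le_iff₀ (by positivity)]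
  refine h1.trans_eq ?_
  field_simp

lemma tendsto_succ_mul (hl : SVSeq l)
    (hq : Tendsto (fun n => q n * rho n ^ 6 / l n) atTop (nhds c)) :
    Tendsto (fun n : ℕ => ((n : ℝ) + 1) * q (n + 1) * rho n ^ 2 / l n) atTop (nhds c) := by
  have h := (((tendsto_add_atTop_iff_nat 1).2 hq).div (tendsto_rho_succ_div.pow 6)
    (by norm_num)).mul hl.tendsto_succ_div
  norm_num at h
  refine h.congr fun n => ?_
  have := rho_pos n
  have := rho_pos (n + 1)
  have := hl.pos n
  have := hl.pos (n + 1)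
  rw [← rho_pow_four]
  field_simp

/-- The pointwise bound is used at the larger index, the bound on partial sums at the smaller one.
The result is linear in M with D independent of M, and it uses only indices up to j, as the
induction in `exists_u_le` requires. -/
lemma exists_sum_sq_le (h : IsRenewal q u) (hl : SVSeq l) (hc : 0 < c)
    (hq : Tendsto (fun n => q n * rho n ^ 6 / l n) atTop (nhds c)) :
    ∃ D : ℝ, 0 < D ∧ ∀ M : ℝ, 0 ≤ M → ∀ j, (∀ i ≤ j, u i ≤ M * (1 / (l i * rho i ^ 2))) →
      ∑ r ∈ antidiagonal j, u r.1 * u r.2 ≤ M * (D * ((l j)⁻¹ * (l j)⁻¹)) := by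
  obtain ⟨C, hC, hb⟩ := h.exists_inv_tail_le hl hc hq
  obtain ⟨D, hD, hd⟩ := hl.exists_inv_mul_rho_sq_le
  refine ⟨2 * D * C, by positivity, fun M hM j hj => ?_⟩
  have rj := rho_pos j
  have lj := hl.pos j
  set B := M * (D / (l j * rho j ^ 2)) with hB
  have hB0 : 0 ≤ B := by positivity
  have key : ∀ r ∈ antidiagonal j, r.1 ≤ r.2 → u r.2 ≤ B := by
    intro r hr hle
    have hr' := rho_le_two_mul_of_antidiagonal hr hle
    rw [Finset.HasAntidiagonal.mem_antidiagonal] at hr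
    refine (hj r.2 (by omega)).trans ?_
    exact mul_le_mul_of_nonneg_left (hd _ _ (by omega) hr') hM
  have pt : ∀ r ∈ antidiagonal j, u r.1 * u r.2 ≤ B * u r.1 + B * u r.2 := by
    intro r hr
    have u1 := h.u_nonneg r.1
    have u2 := h.u_nonneg r.2
    rcases le_total r.1 r.2 with hle | hle
    · have := mul_le_mul_of_nonneg_left (key r hr hle) u1
      have : 0 ≤ B * u r.2 := by positivity
      linarith
    · have := key r.swap (by simpa [add_comm] using hr) hle
      have := mul_le_mul_of_nonneg_right this u2
      simp only [Prod.snd_swap] at this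
      have : 0 ≤ B * u r.1 := by positivity
      linarith
  have s1 : ∑ r ∈ antidiagonal j, u r.1 ≤ C * (rho j ^ 2 / l j) := by
    rw [Finset.Nat.sum_antidiagonal_eq_sum_range_succ_mk]
    exact (h.sum_u_le (eventually_pos hl hc hq) j).trans (hb j)
  have s2 : ∑ r ∈ antidiagonal j, u r.2 ≤ C * (rho j ^ 2 / l j) := by
    rw [← Finset.Nat.sum_antidiagonal_swap]
    exact s1
  calc _ ≤ ∑ r ∈ antidiagonal j, (B * u r.1 + B * u r.2) := Finset.sum_le_sum pt
    _ = B * ∑ r ∈ antidiagonal j, u r.1 + B * ∑ r ∈ antidiagonal j, u r.2 := by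
        rw [Finset.sum_add_distrib, Finset.mul_sum, Finset.mul_sum]
    _ ≤ B * (C * (rho j ^ 2 / l j)) + B * (C * (rho j ^ 2 / l j)) := by gcongr
    _ = _ := by rw [hB]; field_simp; ring

/-- The upper bound in the local renewal theorem. -/
lemma exists_u_le (h : IsRenewal q u) (hl : SVSeq l) (hc : 0 < c)
    (hq : Tendsto (fun n => q n * rho n ^ 6 / l n) atTop (nhds c)) :
    ∃ M : ℝ, 0 < M ∧ ∀ n, u n ≤ M * (1 / (l n * rho n ^ 2)) := by
  obtain ⟨Ct, hCt, hbt⟩ := h.exists_inv_tail_le hl hc hq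
  obtain ⟨D, hD, hd⟩ := h.exists_sum_sq_le hl hc hq
  obtain ⟨Cg, hCg, hbg⟩ := exists_abs_le_of_tendsto (tendsto_succ_mul hl hq)
  obtain ⟨Cl, hCl, hbl⟩ := hl.exists_le_div
  obtain ⟨Ci, hCi, hbi⟩ := (hl.inv.mul hl.inv).exists_le_of_rho_le
  obtain ⟨E, hE, he⟩ := hl.exists_inv_mul_rho_sq_le
  set K1 := 4 * (Cg * Cl) * (D * Ci) with hK1
  set K2 := Cg * Cl * Ct ^ 2 with hK2
  -- Edge terms, where the induction hypothesis is used, contribute K1 θ M; the others contribute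
  -- K2/θ³ independently of M. With E the cost of passing from n to n + 1, θ makes the first share
  -- at most M/2, and M is chosen so that the second is too.
  set θ := min (1 / 2) (1 / (2 * K1 * E)) with hθdef
  have hθ : 0 < θ := by positivity
  have hθ2 : θ ≤ 1 / 2 := min_le_left _ _
  have hθK : K1 * θ * E ≤ 1 / 2 := by
    have : θ ≤ 1 / (2 * K1 * E) := min_le_right _ _
    rw [le_div_iff₀ (by positivity)] at this
    linarith
  set M := max (u 0 * (l 0 * rho 0 ^ 2)) (2 * (K2 / θ ^ 3 * E)) with hM
  have hM2 : 2 * (K2 / θ ^ 3 * E) ≤ M := le_max_right _ _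
  have hM0 : 0 < M := lt_of_lt_of_le (by positivity) hM2
  refine ⟨M, hM0, fun n => ?_⟩
  induction n using Nat.strong_induction_on with
  | _ n ih =>
  cases n with
  | zero =>
    have := rho_pos 0
    have := hl.pos 0
    rw [mul_one_div, le_div_iff₀ (by positivity)]
    exact le_max_left _ _
  | succ n =>
    have rn := rho_pos n
    have ln := hl.pos n
    have hw : ∀ j ≤ n, ∑ r ∈ antidiagonal j, u r.1 * u r.2 ≤ M * (D * ((l j)⁻¹ * (l j)⁻¹)) :=
      fun j hj => hd M hM0.le j fun i hi => ih i (by omega)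
    have hg : ∀ i ≤ n, ((i : ℝ) + 1) * q (i + 1) ≤ Cg * Cl * (rho n * l n) * (1 / rho i ^ 3) := by
      intro i hi
      have ri := rho_pos i
      have li := hl.pos i
      have h1 := (le_abs_self _).trans (hbg i)
      rw [div_le_iff₀ li, ← le_div_iff₀ (by positivity)] at h1
      have h2 := hbl i n hi
      calc _ ≤ Cg * l i / rho i ^ 2 := h1
        _ ≤ Cg * (Cl * (rho n / rho i) * l n) / rho i ^ 2 := by gcongr
        _ = _ := by field_simp
    set w : ℕ → ℝ := fun j => ∑ r ∈ antidiagonal j, u r.1 * u r.2 with hwdef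
    have pt : ∀ p ∈ antidiagonal n, ((p.1 : ℝ) + 1) * q (p.1 + 1) * w p.2 ≤
        Cg * Cl * (rho n * l n) * (M * (D * (Ci * ((l n)⁻¹ * (l n)⁻¹)))) *
          (if (p.1 : ℝ) + 1 ≤ θ ^ 4 * (n + 1) then 1 / rho p.1 ^ 3 else 0) +
        Cg * Cl * l n / (θ ^ 3 * rho n ^ 2) * w p.2 := by
      intro p hp
      have hp' := Finset.HasAntidiagonal.mem_antidiagonal.1 hp
      have w0 : 0 ≤ w p.2 := h.sum_sq_nonneg _
      have r1 := rho_pos p.1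
      have hg1 := hg p.1 (by omega)
      split_ifs with c1
      · have hr : rho n ≤ 2 * rho p.2 := rho_le_of_add_eq hθ.le hθ2 (by omega) c1
        have h2 := hbi p.2 n (by omega) hr
        have h3 := hw p.2 (by omega)
        calc _ ≤ Cg * Cl * (rho n * l n) * (1 / rho p.1 ^ 3) *
              (M * (D * (Ci * ((l n)⁻¹ * (l n)⁻¹)))) := by
              refine mul_le_mul hg1 (h3.trans ?_) w0 (by positivity)
              gcongr
          _ = Cg * Cl * (rho n * l n) * (M * (D * (Ci * ((l n)⁻¹ * (l n)⁻¹)))) *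
              (1 / rho p.1 ^ 3) := by ring
          _ ≤ _ := le_add_of_nonneg_right (by positivity)
      · rw [mul_zero, zero_add]
        refine mul_le_mul_of_nonneg_right (hg1.trans ?_) w0
        have hr : θ * rho n ≤ rho p.1 := by
          refine le_rho_of_le ?_
          rw [mul_pow, rho_pow_four]
          exact (not_le.1 c1).le
        calc _ ≤ Cg * Cl * (rho n * l n) * (1 / (θ * rho n) ^ 3) := by gcongr
          _ = _ := by field_simp
    have tot : ((n : ℝ) + 1) * u (n + 1) ≤ (K1 * θ * M + K2 / θ ^ 3) * (rho n ^ 2 / l n) := by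
      rw [h.succ_mul_u_succ]
      calc _ ≤ _ := Finset.sum_le_sum pt
        _ = Cg * Cl * (rho n * l n) * (M * (D * (Ci * ((l n)⁻¹ * (l n)⁻¹)))) *
            ∑ p ∈ antidiagonal n,
              (if (p.1 : ℝ) + 1 ≤ θ ^ 4 * (n + 1) then 1 / rho p.1 ^ 3 else 0) +
            Cg * Cl * l n / (θ ^ 3 * rho n ^ 2) * ∑ p ∈ antidiagonal n, w p.2 := by
            rw [Finset.sum_add_distrib, Finset.mul_sum, Finset.mul_sum]
        _ ≤ Cg * Cl * (rho n * l n) * (M * (D * (Ci * ((l n)⁻¹ * (l n)⁻¹)))) *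
            (4 * (θ * rho n)) +
            Cg * Cl * l n / (θ ^ 3 * rho n ^ 2) * (Ct * (rho n ^ 2 / l n)) ^ 2 := by
            have t0 := h.tail_pos (eventually_pos hl hc hq) n
            gcongr
            · exact sum_antidiagonal_fst_inv_rho_cube_filter_le n hθ.le
            · refine (h.sum_sq_le (eventually_pos hl hc hq) n).trans ?_
              gcongr
              exact hbt n
        _ = _ := by rw [hK1, hK2]; field_simp
    have hfin := he n (n + 1) n.le_succ (rho_succ_le n)
    rw [← rho_pow_four] at tot
    have h5 : u (n + 1) ≤ (K1 * θ * M + K2 / θ ^ 3) * (1 / (l n * rho n ^ 2)) := by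
      have e : (K1 * θ * M + K2 / θ ^ 3) * (rho n ^ 2 / l n) =
        rho n ^ 4 * ((K1 * θ * M + K2 / θ ^ 3) * (1 / (l n * rho n ^ 2))) := by field_simp
      rw [e] at tot
      exact le_of_mul_le_mul_left tot (by positivity)
    have ln1 := hl.pos (n + 1)
    have rn1 := rho_pos (n + 1)
    calc u (n + 1) ≤ _ := h5
      _ ≤ (K1 * θ * M + K2 / θ ^ 3) * (E / (l (n + 1) * rho (n + 1) ^ 2)) := by gcongr
      _ = (K1 * θ * E * M + K2 / θ ^ 3 * E) * (1 / (l (n + 1) * rho (n + 1) ^ 2)) := by ring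
      _ ≤ M * (1 / (l (n + 1) * rho (n + 1) ^ 2)) := by
          gcongr
          nlinarith

/-- In `sum_u_mul_conv` the inner convolution is asymptotic to κ l, so it can be replaced by the
constant κ l(n) except at small second index. What remains is κ l(n) ∑ u_k against the explicit (2n
+ 1) `invSqrtCoeff n`. -/
lemma tendsto_sum_u (h : IsRenewal q u) (hl : SVSeq l) (hc : 0 < c)
    (hq : Tendsto (fun n => q n * rho n ^ 6 / l n) atTop (nhds c)) :
    Tendsto (fun n => (∑ k ∈ Finset.range (n + 1), u k) * l n / rho n ^ 2) atTop
      (nhds (1 / (Real.pi * c))) := by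
  have hsπ : 0 < Real.sqrt Real.pi := Real.sqrt_pos.2 Real.pi_pos
  have hππ : Real.sqrt Real.pi * Real.sqrt Real.pi = Real.pi := Real.mul_self_sqrt Real.pi_pos.le
  set v : ℕ → ℝ := fun n => ∑ r ∈ antidiagonal n, tail q r.1 * invSqrtCoeff r.2 with hv
  set κ := Real.pi * (2 * c) * (1 / Real.sqrt Real.pi) with hκ
  have hκ0 : 0 < κ := by positivity
  have hvl : Tendsto (fun n => v n / l n) atTop (nhds κ) := by
    have := tendsto_sum_antidiagonal_mul hl svSeq_one (b := invSqrtCoeff)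
      (B := 1 / Real.sqrt Real.pi) (tendsto_tail hl h.hasSum hq)
      (by simpa using tendsto_invSqrtCoeff_mul_rho_sq)
    refine this.congr fun n => ?_
    rw [mul_one]
  obtain ⟨Ct, hCt, hbt⟩ := h.exists_inv_tail_le hl hc hq
  obtain ⟨M, hM, hu⟩ := h.exists_u_le hl hc hq
  obtain ⟨Cv, hCv, hbv⟩ := exists_abs_le_of_tendsto hvl
  obtain ⟨E, hE, he⟩ := hl.exists_inv_mul_rho_sq_le
  have hqp := eventually_pos hl hc hq
  have diff : Tendsto (fun n : ℕ => (2 * (n : ℝ) + 1) * invSqrtCoeff n / rho n ^ 2 -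
      κ * ((∑ k ∈ Finset.range (n + 1), u k) * l n / rho n ^ 2)) atTop (nhds 0) := by
    rw [Metric.tendsto_atTop']
    intro ε hε
    set K := Cv * Ct + 4 * κ * (M * E) with hK
    set θ := min (1 / 2) (ε / (4 * K)) with hθdef
    have hθ : 0 < θ := by positivity
    have hθ2 : θ ≤ 1 / 2 := min_le_left _ _
    have hθε : K * θ ≤ ε / 4 := by
      have : θ ≤ ε / (4 * K) := min_le_right _ _
      rw [le_div_iff₀ (by positivity)] at this
      linarith
    obtain ⟨δ, hδ, hd⟩ := exists_delta_four κ 1 (by positivity : 0 < ε / (4 * Ct))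
    have evv : ∀ᶠ k in atTop, |v k / l k - κ| ≤ δ :=
      (Metric.tendsto_nhds.1 hvl δ hδ).mono fun n hn => by rw [Real.dist_eq] at hn; exact hn.le
    obtain ⟨N, hN⟩ := eventually_atTop.1 ((SVSeq.eventually_of_le (θ := θ ^ 4) (by positivity)
      evv).and (hl.unif' (η := θ ^ 4) (by positivity) hδ))
    refine ⟨N, fun n hn => ?_⟩
    obtain ⟨h1, h2⟩ := hN n (le_of_lt hn)
    have rn := rho_pos n
    have ln := hl.pos n
    have e : (2 * (n : ℝ) + 1) * invSqrtCoeff n / rho n ^ 2 -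
        κ * ((∑ k ∈ Finset.range (n + 1), u k) * l n / rho n ^ 2) =
        (∑ p ∈ antidiagonal n, u p.1 * (v p.2 - κ * l n)) / rho n ^ 2 := by
      have e1 : ∑ k ∈ Finset.range (n + 1), u k = ∑ p ∈ antidiagonal n, u p.1 := by
        rw [Finset.Nat.sum_antidiagonal_eq_sum_range_succ_mk]
      rw [← h.sum_u_mul_conv, e1]
      simp_rw [mul_sub]
      rw [Finset.sum_sub_distrib, ← Finset.sum_mul]
      ring
    have pt : ∀ p ∈ antidiagonal n, |u p.1 * (v p.2 - κ * l n)| ≤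
        ε / (4 * Ct) * l n * u p.1 + Cv * Ct * θ ^ 2 * rho n ^ 2 * (u p.1 * tail q p.2) +
        κ * (M * E) * θ ^ 3 * rho n *
          (if (p.2 : ℝ) + 1 ≤ θ ^ 4 * (n + 1) then 1 / rho p.2 ^ 3 else 0) := by
      intro p hp
      have hp' := Finset.HasAntidiagonal.mem_antidiagonal.1 hp
      have u0 := h.u_nonneg p.1
      have t0 := h.tail_pos hqp p.2
      have r2 := rho_pos p.2
      have r1 := rho_pos p.1
      have l1 := hl.pos p.1
      have l2 := hl.pos p.2
      rw [abs_mul, abs_of_nonneg u0]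
      by_cases c1 : (p.2 : ℝ) + 1 ≤ θ ^ 4 * (n + 1)
      · rw [if_pos c1]
        have hr2 : rho p.2 ≤ θ * rho n := by
          refine rho_le_of_le (by positivity) ?_
          rwa [mul_pow, rho_pow_four]
        have hr1 : rho n ≤ 2 * rho p.1 := rho_le_of_add_eq hθ.le hθ2 hp' c1
        -- At the edge v is traded for a small multiple of the tail, because the convolution of u
        -- with the tail equals 1.
        have a1 : |v p.2| ≤ Cv * Ct * θ ^ 2 * rho n ^ 2 * tail q p.2 := by
          have b1 := hbv p.2
          rw [abs_div, abs_of_pos l2, div_le_iff₀ l2] at b1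
          have b2 := hbt p.2
          rw [← mul_div_assoc, div_le_div_iff₀ t0 l2, one_mul] at b2
          calc |v p.2| ≤ Cv * l p.2 := b1
            _ ≤ Cv * (Ct * rho p.2 ^ 2 * tail q p.2) := by gcongr
            _ ≤ Cv * (Ct * (θ * rho n) ^ 2 * tail q p.2) := by gcongr
            _ = _ := by ring
        have a2 : u p.1 * (κ * l n) ≤ κ * (M * E) * θ ^ 3 * rho n * (1 / rho p.2 ^ 3) := by
          calc u p.1 * (κ * l n) ≤ M * (E / (l n * rho n ^ 2)) * (κ * l n) := by
                gcongr
                exact (hu p.1).trans (mul_le_mul_of_nonneg_left (he _ _ (by omega) hr1) hM.le)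
            _ = κ * (M * E) / rho n ^ 2 * rho p.2 ^ 3 * (1 / rho p.2 ^ 3) := by field_simp
            _ ≤ κ * (M * E) / rho n ^ 2 * (θ * rho n) ^ 3 * (1 / rho p.2 ^ 3) := by gcongr
            _ = _ := by field_simp
        calc u p.1 * |v p.2 - κ * l n| ≤ u p.1 * (|v p.2| + κ * l n) := by
              gcongr
              refine (abs_sub _ _).trans_eq ?_
              rw [abs_of_pos (by positivity : 0 < κ * l n)]
          _ = u p.1 * |v p.2| + u p.1 * (κ * l n) := by ring
          _ ≤ u p.1 * (Cv * Ct * θ ^ 2 * rho n ^ 2 * tail q p.2) + _ :=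
              add_le_add (mul_le_mul_of_nonneg_left a1 u0) a2
          _ ≤ _ := by
              have : 0 ≤ ε / (4 * Ct) * l n * u p.1 := by positivity
              linarith
      · rw [if_neg c1, mul_zero, add_zero]
        have c2 := (not_le.1 c1).le
        have h5 := hd (v p.2 / l p.2) 1 (l p.2 / l n) 1 (h1 _ c2) (by simpa using hδ.le)
          (h2 _ (by omega) c2) (by simpa using hδ.le)
        have e2 : v p.2 - κ * l n = (v p.2 / l p.2 * (l p.2 / l n) - κ) * l n := by
          field_simp
        simp only [mul_one] at h5
        rw [e2, abs_mul, abs_of_pos ln]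
        calc _ ≤ u p.1 * (ε / (4 * Ct) * l n) := by gcongr
          _ = ε / (4 * Ct) * l n * u p.1 := by ring
          _ ≤ _ := le_add_of_nonneg_right (by positivity)
    have su : ∑ p ∈ antidiagonal n, u p.1 ≤ Ct * (rho n ^ 2 / l n) := by
      rw [Finset.Nat.sum_antidiagonal_eq_sum_range_succ_mk]
      exact (h.sum_u_le hqp n).trans (hbt n)
    rw [Real.dist_eq, sub_zero, e, abs_div, abs_of_pos (by positivity : 0 < rho n ^ 2),
      div_lt_iff₀ (by positivity)]
    calc _ ≤ ∑ p ∈ antidiagonal n, |u p.1 * (v p.2 - κ * l n)| := Finset.abs_sum_le_sum_abs _ _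
      _ ≤ _ := Finset.sum_le_sum pt
      _ = ε / (4 * Ct) * l n * ∑ p ∈ antidiagonal n, u p.1 + Cv * Ct * θ ^ 2 * rho n ^ 2 * 1 +
          κ * (M * E) * θ ^ 3 * rho n * ∑ p ∈ antidiagonal n,
          (if (p.2 : ℝ) + 1 ≤ θ ^ 4 * (n + 1) then 1 / rho p.2 ^ 3 else 0) := by
          rw [Finset.sum_add_distrib, Finset.sum_add_distrib, ← Finset.mul_sum, ← Finset.mul_sum,
            ← Finset.mul_sum, h.sum_u_mul_tail]
      _ ≤ ε / (4 * Ct) * l n * (Ct * (rho n ^ 2 / l n)) + Cv * Ct * θ ^ 2 * rho n ^ 2 * 1 +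
          κ * (M * E) * θ ^ 3 * rho n * (4 * (θ * rho n)) := by
          gcongr
          exact sum_antidiagonal_snd_inv_rho_cube_filter_le n hθ.le
      _ = (ε / 4 + Cv * Ct * θ ^ 2 + 4 * κ * (M * E) * θ ^ 4) * rho n ^ 2 := by field_simp
      _ < ε * rho n ^ 2 := by
          gcongr
          have p2 : θ ^ 2 ≤ θ := by nlinarith
          have p4 : θ ^ 4 ≤ θ := by nlinarith
          have q2 : Cv * Ct * θ ^ 2 ≤ Cv * Ct * θ := by gcongr
          have q4 : 4 * κ * (M * E) * θ ^ 4 ≤ 4 * κ * (M * E) * θ := by gcongr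
          have q5 : K * θ = Cv * Ct * θ + 4 * κ * (M * E) * θ := by rw [hK]; ring
          linarith
  have lim : Tendsto (fun n : ℕ => (2 * (n : ℝ) + 1) * invSqrtCoeff n / rho n ^ 2) atTop
      (nhds (2 / Real.sqrt Real.pi)) := by
    have t1 : Tendsto (fun n => 2 - 1 / rho n ^ 4) atTop (nhds (2 - 0)) :=
      tendsto_const_nhds.sub (tendsto_const_nhds.div_atTop
        ((tendsto_pow_atTop (by norm_num)).comp tendsto_rho))
    have t2 := t1.mul tendsto_invSqrtCoeff_mul_rho_sq
    rw [sub_zero, mul_one_div] at t2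
    refine t2.congr fun n => ?_
    have := rho_pos n
    have e1 : (2 * (n : ℝ) + 1) = 2 * rho n ^ 4 - 1 := by rw [rho_pow_four]; ring
    rw [e1]
    field_simp
  have fin := ((lim.sub diff).div_const κ)
  simp only [sub_sub_cancel, sub_zero] at fin
  have e3 : 2 / Real.sqrt Real.pi / κ = 1 / (Real.pi * c) := by
    rw [hκ]; field_simp
  rw [e3] at fin
  refine fin.congr fun n => ?_
  field_simp

/-- The local renewal theorem for a regularly varying mass function of index `-3/2`. -/
theorem tendsto_u (h : IsRenewal q u) (hl : SVSeq l) (hc : 0 < c)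
    (hq : Tendsto (fun n => q n * rho n ^ 6 / l n) atTop (nhds c)) :
    Tendsto (fun n => u n * rho n ^ 2 * l n) atTop (nhds (1 / (2 * Real.pi * c))) := by
  obtain ⟨M, hM, hu⟩ := h.exists_u_le hl hc hq
  obtain ⟨D, hD, hd⟩ := h.exists_sum_sq_le hl hc hq
  set w : ℕ → ℝ := fun j => ∑ r ∈ antidiagonal j, u r.1 * u r.2 with hwdef
  have hw : ∀ j, w j ≤ M * (D * ((l j)⁻¹ * (l j)⁻¹)) :=
    fun j => hd M hM.le j fun i _ => hu i
  have hw0 : ∀ j, 0 ≤ w j := h.sum_sq_nonneg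
  obtain ⟨Cl, hCl, hbl⟩ := hl.exists_le_div
  obtain ⟨Ci, hCi, hbi⟩ := (hl.inv.mul hl.inv).exists_le_div
  -- Both terms are asymptotic to c l(i)/√i, so the difference is of smaller order. It is exactly
  -- what separates U' = Q'U² from half of TU².
  set d : ℕ → ℝ := fun i => ((i : ℝ) + 1) * q (i + 1) - 1 / 2 * tail q i with hddef
  have hdlim : Tendsto (fun i => d i * rho i ^ 2 / l i) atTop (nhds 0) := by
    have := (tendsto_succ_mul hl hq).sub ((tendsto_tail hl h.hasSum hq).const_mul (1 / 2))
    have e0 : c - 1 / 2 * (2 * c) = 0 := by ring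
    rw [e0] at this
    refine this.congr fun n => ?_
    simp only [hddef]
    ring
  set e : ℕ → ℝ := fun i => |d i * rho i ^ 2 / l i| with hedef
  have helim : Tendsto e atTop (nhds 0) := by simpa using hdlim.abs
  obtain ⟨Ce, hCe, hbe⟩ := exists_abs_le_of_tendsto helim
  set K := Cl * (M * (D * Ci)) with hK
  have hK0 : 0 < K := by positivity
  have err : Tendsto (fun n => (∑ p ∈ antidiagonal n, d p.1 * w p.2) * l n / rho n ^ 2) atTop
      (nhds 0) := by
    rw [Metric.tendsto_atTop']
    intro ε hε
    set θ := min (1 / 2) (ε / (32 * K * Ce)) with hθdef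
    have hθ : 0 < θ := by positivity
    have hθ2 : θ ≤ 1 / 2 := min_le_left _ _
    have hθε : 8 * K * Ce * θ ≤ ε / 4 := by
      have : θ ≤ ε / (32 * K * Ce) := min_le_right _ _
      rw [le_div_iff₀ (by positivity)] at this
      linarith
    have eve : ∀ᶠ k in atTop, e k ≤ ε / (160 * K) :=
      (helim.eventually (gt_mem_nhds (by positivity : 0 < ε / (160 * K)))).mono fun n hn => hn.le
    obtain ⟨N, hN⟩ := eventually_atTop.1
      (SVSeq.eventually_of_le (θ := θ ^ 4) (by positivity) eve)
    refine ⟨N, fun n hn => ?_⟩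
    have h1 := hN n (le_of_lt hn)
    have rn := rho_pos n
    have ln := hl.pos n
    have pt : ∀ p ∈ antidiagonal n, |d p.1 * w p.2| ≤ rho n ^ 2 / l n *
        (ε / 160 * (1 / (rho p.1 ^ 3 * rho p.2)) + 2 * K * Ce / rho n *
          (if (p.1 : ℝ) + 1 ≤ θ ^ 4 * (n + 1) then 1 / rho p.1 ^ 3 else 0)) := by
      intro p hp
      have hp' := Finset.HasAntidiagonal.mem_antidiagonal.1 hp
      have r1 := rho_pos p.1
      have r2 := rho_pos p.2
      have l1 := hl.pos p.1
      have l2 := hl.pos p.2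
      have e0 : 0 ≤ e p.1 := abs_nonneg _
      have ed : |d p.1| = e p.1 * l p.1 / rho p.1 ^ 2 := by
        simp only [hedef]
        rw [abs_div, abs_mul, abs_of_pos l1, abs_of_pos (by positivity : 0 < rho p.1 ^ 2)]
        field_simp
      have main : |d p.1 * w p.2| ≤
          rho n ^ 2 / l n * (K * e p.1 * (1 / (rho p.1 ^ 3 * rho p.2))) := by
        rw [abs_mul, abs_of_nonneg (hw0 _), ed]
        calc _ ≤ e p.1 * (Cl * (rho n / rho p.1) * l n) / rho p.1 ^ 2 *
              (M * (D * (Ci * (rho n / rho p.2) * ((l n)⁻¹ * (l n)⁻¹)))) := by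
              refine mul_le_mul ?_ ((hw p.2).trans (mul_le_mul_of_nonneg_left
                (mul_le_mul_of_nonneg_left (hbi p.2 n (by omega)) hD.le) hM.le))
                (hw0 _) (by positivity)
              gcongr
              exact hbl p.1 n (by omega)
          _ = _ := by rw [hK]; field_simp
      refine main.trans ?_
      gcongr
      by_cases c1 : (p.1 : ℝ) + 1 ≤ θ ^ 4 * (n + 1)
      · rw [if_pos c1]
        have hr : rho n ≤ 2 * rho p.2 := rho_le_of_add_eq hθ.le hθ2 (by omega) c1
        have hr2 : 1 / rho p.2 ≤ 2 / rho n := by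
          rw [div_le_div_iff₀ r2 rn]; linarith
        calc K * e p.1 * (1 / (rho p.1 ^ 3 * rho p.2)) ≤
              K * Ce * (1 / (rho p.1 ^ 3 * rho p.2)) := by
              gcongr
              exact (le_abs_self _).trans (hbe _)
          _ = K * Ce * (1 / rho p.1 ^ 3) * (1 / rho p.2) := by field_simp
          _ ≤ K * Ce * (1 / rho p.1 ^ 3) * (2 / rho n) := by gcongr
          _ = 2 * K * Ce / rho n * (1 / rho p.1 ^ 3) := by ring
          _ ≤ _ := le_add_of_nonneg_left (by positivity)
      · rw [if_neg c1, mul_zero, add_zero]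
        gcongr
        have := h1 _ (not_le.1 c1).le
        rw [le_div_iff₀ (by positivity)] at this
        linarith
    rw [Real.dist_eq, sub_zero, mul_div_assoc, abs_mul,
      abs_of_pos (by positivity : 0 < l n / rho n ^ 2)]
    calc _ ≤ (∑ p ∈ antidiagonal n, |d p.1 * w p.2|) * (l n / rho n ^ 2) := by
          gcongr
          exact Finset.abs_sum_le_sum_abs _ _
      _ ≤ (∑ p ∈ antidiagonal n, rho n ^ 2 / l n *
        (ε / 160 * (1 / (rho p.1 ^ 3 * rho p.2)) + 2 * K * Ce / rho n *
          (if (p.1 : ℝ) + 1 ≤ θ ^ 4 * (n + 1) then 1 / rho p.1 ^ 3 else 0))) *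
          (l n / rho n ^ 2) := by
          gcongr with p hp
          exact pt p hp
      _ = ε / 160 * ∑ p ∈ antidiagonal n, 1 / (rho p.1 ^ 3 * rho p.2) + 2 * K * Ce / rho n *
          ∑ p ∈ antidiagonal n,
          (if (p.1 : ℝ) + 1 ≤ θ ^ 4 * (n + 1) then 1 / rho p.1 ^ 3 else 0) := by
          rw [← Finset.mul_sum, Finset.sum_add_distrib, ← Finset.mul_sum, ← Finset.mul_sum]
          field_simp
      _ ≤ ε / 160 * 40 + 2 * K * Ce / rho n * (4 * (θ * rho n)) := by
          gcongr
          · exact sum_antidiagonal_inv_rho_cube_mul_inv_rho_le n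
          · exact sum_antidiagonal_fst_inv_rho_cube_filter_le n hθ.le
      _ = ε / 4 + 8 * K * Ce * θ := by field_simp; ring
      _ < ε := by linarith
  have lim := ((h.tendsto_sum_u hl hc hq).const_mul (1 / 2)).add err
  have key : ∀ n, u (n + 1) * rho n ^ 2 * l n =
      1 / 2 * ((∑ k ∈ Finset.range (n + 1), u k) * l n / rho n ^ 2) +
      (∑ p ∈ antidiagonal n, d p.1 * w p.2) * l n / rho n ^ 2 := by
    intro n
    have rn := rho_pos n
    have e1 : ∑ p ∈ antidiagonal n, d p.1 * w p.2 =
        rho n ^ 4 * u (n + 1) - 1 / 2 * ∑ k ∈ Finset.range (n + 1), u k := by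
      rw [rho_pow_four, h.succ_mul_u_succ, ← h.sum_tail_mul_sq, Finset.mul_sum,
        ← Finset.sum_sub_distrib]
      refine Finset.sum_congr rfl fun p _ => ?_
      simp only [hddef, hwdef]
      ring
    rw [e1]
    field_simp
    ring
  simp_rw [← key] at lim
  have fin := (lim.mul (tendsto_rho_succ_div.pow 2)).mul hl.tendsto_succ_div
  have e4 : (1 / 2 * (1 / (Real.pi * c)) + 0) * 1 ^ 2 * 1 = 1 / (2 * Real.pi * c) := by
    field_simp
    simp
  rw [e4] at fin
  refine (tendsto_add_atTop_iff_nat 1).1 (fin.congr fun n => ?_)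
  have rn := rho_pos n
  have ln := hl.pos n
  field_simp

end IsRenewal

/-! ### From slowly varying functions to slowly varying sequences. -/

/-- The uniform convergence theorem, in additive form. -/
lemma exists_forall_abs_sub_le {h : ℝ → ℝ} (hm : Measurable h)
    (hlim : ∀ v, Tendsto (fun x => h (x + v) - h x) atTop (nhds 0)) {A ε : ℝ} (hε : 0 < ε) :
    ∃ X, ∀ x, X ≤ x → ∀ v, 0 ≤ v → v ≤ A → |h (x + v) - h x| ≤ ε := by
  by_contra! hcon
  choose x hx v hv0 hvA hbad using fun n : ℕ => hcon n
  have hxlim : Tendsto x atTop atTop := tendsto_atTop_mono hx tendsto_natCast_atTop_atTop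
  have hylim : Tendsto (fun n => x n + v n) atTop atTop :=
    tendsto_atTop_mono (fun n => le_add_of_nonneg_right (hv0 n)) hxlim
  have small : ∀ y : ℕ → ℝ, Tendsto y atTop atTop → ∀ᶠ n in atTop,
      volume ({t | ε / 2 ≤ |h (y n + t) - h (y n)|} ∩ Set.Icc 0 (A + 1)) < ENNReal.ofReal (1 / 4) := by
    intro y hy
    have h1 : TendstoInMeasure (volume.restrict (Set.Icc 0 (A + 1)))
        (fun n t => h (y n + t) - h (y n)) atTop (fun _ => 0) := by
      refine tendstoInMeasure_of_tendsto_ae (fun n => ?_) (Eventually.of_forall fun t => ?_)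
      · exact Measurable.aestronglyMeasurable (by fun_prop)
      · exact (hlim t).comp hy
    rw [tendstoInMeasure_iff_norm] at h1
    have h2 := (h1 (ε / 2) (by positivity)).eventually
      (gt_mem_nhds (by simp : (0 : ℝ≥0∞) < ENNReal.ofReal (1 / 4)))
    refine h2.mono fun n hn => ?_
    rw [Measure.restrict_apply (measurableSet_le (by fun_prop) (by fun_prop))] at hn
    simpa [Real.norm_eq_abs] using hn
  obtain ⟨n, h1, h2⟩ := ((small x hxlim).and (small _ hylim)).exists
  set S := {t | ε / 2 ≤ |h (x n + t) - h (x n)|} ∩ Set.Icc 0 (A + 1)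
  set T := {t | ε / 2 ≤ |h (x n + v n + t) - h (x n + v n)|} ∩ Set.Icc 0 (A + 1)
  -- If x + t were a good shift from both x and x + v, the two increments would contradict the
  -- choice of v. So the bad sets cover an interval of length at least 1, while each has measure
  -- below 1/4.
  have hsub : Set.Icc (v n) (A + 1) ⊆ S ∪ (fun t => t + -v n) ⁻¹' T := by
    intro t ht
    by_contra hnot
    rw [Set.mem_union, not_or] at hnot
    obtain ⟨c1, c2⟩ := hnot
    have d1 : |h (x n + t) - h (x n)| < ε / 2 := by
      by_contra hc
      exact c1 ⟨not_lt.1 hc, (hv0 n).trans ht.1, ht.2⟩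
    have d2 : |h (x n + t) - h (x n + v n)| < ε / 2 := by
      by_contra hc
      refine c2 ⟨?_, ?_, ?_⟩
      · have e : x n + v n + (t + -v n) = x n + t := by ring
        change _ ≤ |h (x n + v n + (t + -v n)) - _|
        rw [e]
        exact not_lt.1 hc
      · linarith [ht.1]
      · linarith [ht.2, hv0 n]
    have := hbad n
    rw [abs_sub_comm] at d2
    have := abs_sub_le (h (x n + v n)) (h (x n + t)) (h (x n))
    linarith
  have hle := (measure_mono hsub).trans (measure_union_le (μ := volume) _ _)
  rw [measure_preimage_add_right, Real.volume_Icc] at hle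
  have : ENNReal.ofReal (A + 1 - v n) < ENNReal.ofReal (1 / 4) + ENNReal.ofReal (1 / 4) :=
    hle.trans_lt (ENNReal.add_lt_add h1 h2)
  rw [← ENNReal.ofReal_add (by norm_num) (by norm_num),
    ENNReal.ofReal_lt_ofReal_iff (by norm_num)] at this
  linarith [hvA n]

/-- The function log ∘ L ∘ exp turns ratios into differences, to which uniform convergence applies.
Small indices receive the value 1, since L need not be positive there. -/
lemma SlowlyVarying.exists_svSeq {L : ℝ → ℝ} (h : SlowlyVarying L) :
    ∃ l, SVSeq l ∧ ∀ᶠ n : ℕ in atTop, l n = L n := by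
  obtain ⟨T, hT⟩ := eventually_atTop.1 h.eventually_pos
  refine ⟨fun n => if (T : ℝ) ≤ n then L n else 1, ⟨fun n => ?_, fun η hη ε hε => ?_⟩, ?_⟩
  · split_ifs with h1
    · exact hT _ h1
    · exact one_pos
  · set g : ℝ → ℝ := fun x => Real.log (L (Real.exp x)) with hg
    have hgm : Measurable g := Real.measurable_log.comp (h.measurable.comp Real.measurable_exp)
    have hlim : ∀ v, Tendsto (fun x => g (x + v) - g x) atTop (nhds 0) := by
      intro v
      have h1 := (h.tendsto_ratio (Real.exp v) (Real.exp_pos v)).comp Real.tendsto_exp_atTop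
      have h2 := h1.log one_ne_zero
      rw [Real.log_one] at h2
      have h3 := Real.tendsto_exp_atTop.eventually h.eventually_pos
      have h4 : Tendsto (fun x : ℝ => x + v) atTop atTop :=
        tendsto_atTop_add_const_right _ _ tendsto_id
      refine h2.congr' ?_
      filter_upwards [h3, h4.eventually h3] with x hx hx2
      simp only [Function.comp_apply, hg]
      rw [← Real.exp_add, add_comm v, Real.log_div hx2.ne' hx.ne']
    have hcont : ∃ δ : ℝ, 0 < δ ∧ ∀ y : ℝ, |y| ≤ δ → |Real.exp y - 1| ≤ ε := by
      obtain ⟨δ, hδ, hd⟩ := Metric.continuousAt_iff.1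
        (Real.continuous_exp.continuousAt (x := 0)) ε hε
      refine ⟨δ / 2, by positivity, fun y hy => ?_⟩
      have := hd (x := y) (by rw [Real.dist_eq, sub_zero]; linarith)
      rw [Real.dist_eq, Real.exp_zero] at this
      exact this.le
    obtain ⟨δ, hδ, hd⟩ := hcont
    -- For η n ≤ m ≤ n the shift from log m to log n lies between 0 and log(1/η).
    obtain ⟨X, hX⟩ := exists_forall_abs_sub_le hgm hlim (A := Real.log (1 / η)) hδ
    have e1 : Tendsto (fun n : ℕ => η * (n : ℝ)) atTop atTop :=
      tendsto_natCast_atTop_atTop.const_mul_atTop hη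
    filter_upwards [e1.eventually_ge_atTop (max (max T 1) (Real.exp X))] with n hn m hmn hηm
    have hmn' : (m : ℝ) ≤ n := by exact_mod_cast hmn
    have m1 : (1 : ℝ) ≤ m := ((le_max_right T 1).trans (le_max_left _ _)).trans (hn.trans hηm)
    have mT : T ≤ m := ((le_max_left T 1).trans (le_max_left _ _)).trans (hn.trans hηm)
    have mX : Real.exp X ≤ m := (le_max_right _ _).trans (hn.trans hηm)
    have m0 : (0 : ℝ) < m := by linarith
    have n0 : (0 : ℝ) < n := by linarith
    rw [if_pos mT, if_pos (mT.trans hmn')]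
    have Lm := hT m mT
    have Ln := hT n (mT.trans hmn')
    have key := hX (Real.log m) ((Real.le_log_iff_exp_le m0).2 mX) (Real.log (n / m))
      (Real.log_nonneg (by rw [le_div_iff₀ m0, one_mul]; exact hmn'))
      (Real.log_le_log (by positivity) (by rw [div_le_div_iff₀ m0 hη]; linarith))
    rw [Real.log_div n0.ne' m0.ne', add_sub_cancel, hg] at key
    simp only [Real.exp_log n0, Real.exp_log m0] at key
    rw [abs_sub_comm, ← Real.log_div Lm.ne' Ln.ne'] at key
    have := hd _ key
    rwa [Real.exp_log (by positivity)] at this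
  · filter_upwards [tendsto_natCast_atTop_atTop.eventually_ge_atTop T] with n hn
    rw [if_pos hn]

/-! ### Transfer operators and the decomposition at contacts. -/

lemma lintegral_pi_fin_succ {N : ℕ} (ν : Measure ℝ) [SigmaFinite ν] {f : (Fin (N + 1) → ℝ) → ℝ≥0∞}
    (hf : Measurable f) :
    ∫⁻ x, f x ∂(Measure.pi fun _ => ν) =
      ∫⁻ y, ∫⁻ x : Fin N → ℝ, f (Fin.cons y x) ∂(Measure.pi fun _ => ν) ∂ν := by
  have h := (measurePreserving_piFinSuccAbove (fun _ : Fin (N + 1) => ν) 0).symm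
  rw [← h.lintegral_comp hf, lintegral_prod]
  · simp [MeasurableEquiv.piFinSuccAbove_symm_apply, Fin.insertNthEquiv]
  · exact (hf.comp (MeasurableEquiv.measurable _)).aemeasurable

namespace Wetting

/-- The transfer kernel `exp (-V (y - x))`. -/
noncomputable def kernel (V : ℝ → EReal) (x y : ℝ) : ℝ≥0∞ := EReal.exp (-V (y - x))

/-- The transfer operator of the kernel `K` with respect to `ν`. -/
noncomputable def transfer (K : ℝ → ℝ → ℝ≥0∞) (ν : Measure ℝ) (h : ℝ → ℝ≥0∞) (x : ℝ) : ℝ≥0∞ :=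
  ∫⁻ y, K x y * h y ∂ν

/-- The trajectory started at `x₀` with subsequent positions `x`. -/
def pathFrom (x₀ : ℝ) {N : ℕ} (x : Fin N → ℝ) : ℕ → ℝ
  | 0 => x₀
  | k + 1 => if h : k < N then x ⟨k, h⟩ else 0

lemma path_eq_pathFrom {N : ℕ} (x : Fin N → ℝ) (k : ℕ) : path x k = pathFrom 0 x k := by
  cases k <;> rfl

lemma pathFrom_cons_succ (x₀ y : ℝ) {N : ℕ} (x : Fin N → ℝ) {k : ℕ} :
    pathFrom x₀ (Fin.cons y x : Fin (N + 1) → ℝ) (k + 1) = pathFrom y x k := by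
  cases k with
  | zero => simp [pathFrom]
  | succ k =>
    by_cases h : k < N
    · have h' : k + 1 < N + 1 := by omega
      simp only [pathFrom, h, h', dif_pos]
      exact Fin.cons_succ (α := fun _ => ℝ) y x ⟨k, h⟩
    · have h' : ¬ k + 1 < N + 1 := by omega
      simp only [pathFrom, h, h', dif_neg, not_false_eq_true]

lemma measurable_pathFrom (x₀ : ℝ) (N k : ℕ) :
    Measurable fun x : Fin N → ℝ => pathFrom x₀ x k := by
  cases k with
  | zero => exact measurable_const
  | succ k =>
    by_cases h : k < N
    · simp only [pathFrom, h, dif_pos]; exact measurable_pi_apply _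
    · simp only [pathFrom, h, dif_neg, not_false_eq_true]; exact measurable_const

lemma measurable_kernel {V : ℝ → EReal} (hV : Measurable V) :
    Measurable (Function.uncurry (kernel V)) :=
  (hV.comp (measurable_snd.sub measurable_fst)).neg.ereal_exp

lemma measurable_transfer {K : ℝ → ℝ → ℝ≥0∞} (hK : Measurable (Function.uncurry K))
    (ν : Measure ℝ) [SFinite ν] {h : ℝ → ℝ≥0∞} (hh : Measurable h) :
    Measurable (transfer K ν h) :=
  Measurable.lintegral_prod_right' (f := fun p : ℝ × ℝ => K p.1 p.2 * h p.2)
    (hK.mul (hh.comp measurable_snd))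

lemma measurable_transfer_iterate {K : ℝ → ℝ → ℝ≥0∞} (hK : Measurable (Function.uncurry K))
    (ν : Measure ℝ) [SFinite ν] {h : ℝ → ℝ≥0∞} (hh : Measurable h) (n : ℕ) :
    Measurable ((transfer K ν)^[n] h) := by
  induction n with
  | zero => exact hh
  | succ n ih => rw [Function.iterate_succ_apply']; exact measurable_transfer hK ν ih

lemma measurable_prod_kernel {K : ℝ → ℝ → ℝ≥0∞} (hK : Measurable (Function.uncurry K))
    {h : ℝ → ℝ≥0∞} (hh : Measurable h) (x₀ : ℝ) (N M : ℕ) :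
    Measurable fun x : Fin N → ℝ =>
      (∏ i ∈ Finset.range M, K (pathFrom x₀ x i) (pathFrom x₀ x (i + 1))) *
        h (pathFrom x₀ x M) :=
  (Finset.measurable_prod _ fun i _ =>
    hK.comp ((measurable_pathFrom x₀ N i).prodMk (measurable_pathFrom x₀ N (i + 1)))).mul
    (hh.comp (measurable_pathFrom x₀ N M))

lemma lintegral_prod_kernel {K : ℝ → ℝ → ℝ≥0∞} (hK : Measurable (Function.uncurry K))
    (ν : Measure ℝ) [SigmaFinite ν] {h : ℝ → ℝ≥0∞} (hh : Measurable h) (N : ℕ) (x₀ : ℝ) :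
    ∫⁻ x : Fin N → ℝ, (∏ i ∈ Finset.range N, K (pathFrom x₀ x i) (pathFrom x₀ x (i + 1))) *
      h (pathFrom x₀ x N) ∂(Measure.pi fun _ => ν) = (transfer K ν)^[N] h x₀ := by
  induction N generalizing x₀ with
  | zero => simp [pathFrom]
  | succ N ih =>
    rw [lintegral_pi_fin_succ ν (measurable_prod_kernel hK hh x₀ (N + 1) (N + 1)),
      Function.iterate_succ_apply', transfer]
    refine lintegral_congr fun y => ?_
    rw [← ih y, ← lintegral_const_mul _ (measurable_prod_kernel hK hh y N N)]
    refine lintegral_congr fun x => ?_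
    rw [Finset.prod_range_succ']
    simp_rw [pathFrom_cons_succ]
    simp only [pathFrom]
    ring

/-- The first conjunct carries the induction: in `EReal`, negation distributes over a sum only when
⊥ + ⊤ is excluded. -/
lemma exp_neg_sum {V : ℝ → EReal} (hV : ∀ x, V x ≠ ⊥) (f : ℕ → ℝ) (N : ℕ) :
    (∑ i ∈ Finset.range N, V (f i)) ≠ ⊥ ∧
      EReal.exp (-∑ i ∈ Finset.range N, V (f i)) = ∏ i ∈ Finset.range N, EReal.exp (-V (f i)) := by
  induction N with
  | zero => simp
  | succ N ih =>
    rw [Finset.sum_range_succ, Finset.prod_range_succ, ← ih.2, ← EReal.exp_add,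
      EReal.neg_add (Or.inl ih.1) (Or.inr (hV _)), sub_eq_add_neg]
    exact ⟨by simp [EReal.add_eq_bot_iff, ih.1, hV], rfl⟩

variable {μ : Measure ℝ} {V : ℝ → EReal}

instance [SigmaFinite μ] (ε : ℝ≥0) : SigmaFinite (siteMeasure μ ε) := by
  unfold siteMeasure
  have : IsFiniteMeasure ((ε : ℝ≥0∞) • Measure.dirac (0 : ℝ)) :=
    ⟨by simp⟩
  infer_instance

lemma Zfree_eq [SigmaFinite μ] (hV : Measurable V) (hbot : ∀ x, V x ≠ ⊥) (ε : ℝ≥0) (N : ℕ) :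
    Zfree μ V ε N = (transfer (kernel V) (siteMeasure μ ε))^[N] (fun _ => 1) 0 := by
  rw [← lintegral_prod_kernel (measurable_kernel hV) _ measurable_const, Zfree]
  refine lintegral_congr fun x => ?_
  rw [hamFree, (exp_neg_sum hbot (fun i => path x (i + 1) - path x i) N).2, mul_one]
  simp only [path_eq_pathFrom, kernel]

lemma Zcon_eq [SigmaFinite μ] (hV : Measurable V) (hbot : ∀ x, V x ≠ ⊥) (ε : ℝ≥0) (N : ℕ) :
    Zcon μ V ε N =
      (transfer (kernel V) (siteMeasure μ ε))^[N] (fun x => kernel V x 0) 0 := by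
  have hk : Measurable fun x => kernel V x 0 :=
    (measurable_kernel hV).comp (measurable_id.prodMk measurable_const)
  rw [← lintegral_prod_kernel (measurable_kernel hV) _ hk, Zcon]
  refine lintegral_congr fun x => ?_
  rw [hamCon, (exp_neg_sum hbot (fun i => path x (i + 1) - path x i) (N + 1)).2,
    Finset.prod_range_succ]
  simp only [path_eq_pathFrom, kernel]
  simp [pathFrom]

lemma transfer_siteMeasure {K : ℝ → ℝ → ℝ≥0∞} (ε : ℝ≥0) (h : ℝ → ℝ≥0∞) (x : ℝ) :
    transfer K (siteMeasure μ ε) h x =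
      transfer K (siteMeasure μ 0) h x + K x 0 * (ε * h 0) := by
  simp only [transfer, siteMeasure, lintegral_add_measure, lintegral_smul_measure,
    lintegral_dirac, smul_eq_mul]
  simp
  ring

/-- The decomposition of a trajectory at its first contact with the origin. -/
lemma transfer_iterate_succ [SigmaFinite μ] {K : ℝ → ℝ → ℝ≥0∞}
    (hK : Measurable (Function.uncurry K)) (ε : ℝ≥0) {h : ℝ → ℝ≥0∞} (hh : Measurable h)
    (n : ℕ) (x : ℝ) :
    (transfer K (siteMeasure μ ε))^[n + 1] h x =
      (transfer K (siteMeasure μ 0))^[n + 1] h x + ∑ p ∈ antidiagonal n,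
        (transfer K (siteMeasure μ 0))^[p.1] (fun x => K x 0) x *
          (ε * (transfer K (siteMeasure μ ε))^[p.2] h 0) := by
  have hK0 : Measurable fun x => K x 0 := hK.comp (measurable_id.prodMk measurable_const)
  induction n generalizing x with
  | zero => simp [transfer_siteMeasure ε h]
  | succ n ih =>
    have e : ∀ a : ℝ → ℝ≥0∞, (transfer K (siteMeasure μ 0)) a x =
      ∫⁻ y, K x y * a y ∂(siteMeasure μ 0) := fun _ => rfl
    have hKx : Measurable (K x) := hK.comp (measurable_const.prodMk measurable_id)
    rw [Function.iterate_succ_apply' _ (n + 1), transfer_siteMeasure, e]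
    have hm : Measurable fun y => K x y * (transfer K (siteMeasure μ 0))^[n + 1] h y :=
      hKx.mul (measurable_transfer_iterate hK _ hh _)
    rw [lintegral_congr fun y => by rw [ih y, mul_add], lintegral_add_left hm,
      ← e, ← Function.iterate_succ_apply' (transfer K (siteMeasure μ 0)) (n + 1)]
    rw [Finset.Nat.antidiagonal_succ, Finset.sum_cons, Finset.sum_map, add_assoc]
    congr 1
    rw [add_comm]
    congr 1
    simp_rw [Finset.mul_sum]
    rw [lintegral_finsetSum _ fun p _ => by
      exact hKx.mul ((measurable_transfer_iterate hK _ hK0 _).mul_const _)]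
    refine Finset.sum_congr rfl fun p _ => ?_
    simp only [Function.Embedding.prodMap, Function.Embedding.coeFn_mk, Prod.map,
      Nat.succ_eq_add_one, Function.Embedding.refl_apply]
    have hm' : Measurable fun y =>
        K x y * (transfer K (siteMeasure μ 0))^[p.1] (fun x => K x 0) y :=
      hKx.mul (measurable_transfer_iterate hK _ hK0 _)
    rw [Function.iterate_succ_apply', e, ← lintegral_mul_const _ hm']
    simp_rw [mul_assoc]

lemma Zcon_succ [SigmaFinite μ] (hV : Measurable V) (hbot : ∀ x, V x ≠ ⊥) (ε : ℝ≥0) (n : ℕ) :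
    Zcon μ V ε (n + 1) = Zcon μ V 0 (n + 1) +
      ∑ p ∈ antidiagonal n, Zcon μ V 0 p.1 * (ε * Zcon μ V ε p.2) := by
  simp only [Zcon_eq hV hbot]
  exact transfer_iterate_succ (measurable_kernel hV) ε
    ((measurable_kernel hV).comp (measurable_id.prodMk measurable_const)) n 0

lemma Zfree_succ [SigmaFinite μ] (hV : Measurable V) (hbot : ∀ x, V x ≠ ⊥) (ε : ℝ≥0) (n : ℕ) :
    Zfree μ V ε (n + 1) = Zfree μ V 0 (n + 1) +
      ∑ p ∈ antidiagonal n, Zcon μ V 0 p.1 * (ε * Zfree μ V ε p.2) := by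
  simp only [Zcon_eq hV hbot, Zfree_eq hV hbot]
  exact transfer_iterate_succ (measurable_kernel hV) ε measurable_const n 0

instance : SigmaFinite intCount := by
  have e : intCount = Measure.map (fun k : ℤ => (k : ℝ)) Measure.count := by
    rw [intCount, Measure.count, Measure.map_sum (by fun_prop)]
    simp [Measure.map_dirac]
  rw [e]
  exact MeasurableEmbedding.sigmaFinite_map
    (Int.isClosedEmbedding_coe_real.measurableEmbedding)

/-! ### The random walk and its probability of staying positive. -/

lemma IsModel.sigmaFinite (h : IsModel μ V) : SigmaFinite μ := by
  rcases h.setup with ⟨rfl, -⟩ | rfl <;> infer_instance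

/-- The a priori measure is carried by a set whose translations preserve it. -/
lemma IsModel.exists_translations (h : IsModel μ V) : ∃ S : Set ℝ, 0 ∈ S ∧ (∀ᵐ z ∂μ, z ∈ S) ∧
    ∀ x ∈ S, ∀ f : ℝ → ℝ≥0∞, ∫⁻ y, f (x + y) ∂μ = ∫⁻ y, f y ∂μ := by
  rcases h.setup with ⟨rfl, -⟩ | rfl
  · exact ⟨Set.univ, trivial, by simp, fun x _ f => lintegral_add_left_eq_self f x⟩
  · refine ⟨Set.range fun k : ℤ => (k : ℝ), ⟨0, by simp⟩, ?_, ?_⟩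
    · rw [intCount, Measure.ae_sum_iff]
      intro k
      simp [ae_dirac_eq]
    · rintro _ ⟨m, rfl⟩ f
      simp only [intCount, lintegral_sum_measure, lintegral_dirac]
      rw [← (Equiv.addLeft m).tsum_eq (fun k : ℤ => f k)]
      simp

lemma stepLaw_univ_le : stepLaw μ V Set.univ ≤ 1 := by
  simp only [stepLaw, Measure.smul_apply, smul_eq_mul, withDensity_apply _ MeasurableSet.univ,
    Measure.restrict_univ]
  exact ENNReal.inv_mul_le_one _

instance : IsFiniteMeasure (stepLaw μ V) := ⟨stepLaw_univ_le.trans_lt ENNReal.one_lt_top⟩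

/-- The trajectories of increments which stay positive when started at `x₀`. -/
def positiveSet (x₀ : ℝ) (n : ℕ) : Set (Fin n → ℝ) :=
  {y | ∀ i : Fin n, 0 < x₀ + ∑ j ∈ Finset.Iic i, y j}

lemma measurableSet_positiveSet (x₀ : ℝ) (n : ℕ) : MeasurableSet (positiveSet x₀ n) := by
  simp only [positiveSet, Set.ofPred_forall]
  exact MeasurableSet.iInter fun i => measurableSet_lt measurable_const (by fun_prop)

lemma cons_mem_positiveSet (x₀ y : ℝ) {n : ℕ} (x : Fin n → ℝ) :
    (Fin.cons y x : Fin (n + 1) → ℝ) ∈ positiveSet x₀ (n + 1) ↔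
      0 < x₀ + y ∧ x ∈ positiveSet (x₀ + y) n := by
  have e : ∀ (m : ℕ) (f : Fin m → ℝ) (i : Fin m),
      ∑ j ∈ Finset.Iic i, f j = ∑ j, if j ≤ i then f j else 0 := by
    intro m f i
    rw [← Finset.sum_filter]
    congr 1
    ext j
    simp
  simp only [positiveSet, Set.mem_ofPred_eq, Fin.forall_fin_succ, e, Fin.sum_univ_succ,
    Fin.cons_zero, Fin.cons_succ, Fin.succ_le_succ_iff, Fin.zero_le, if_true, add_assoc]
  simp

/-- Translating by the current height turns an integral over increments into one over heights. The
heights stay in S because counting measure is invariant only under integer translations. -/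
lemma pi_stepLaw_positiveSet [SigmaFinite μ] (hV : Measurable V) (hbot : ∀ x, V x ≠ ⊥) {S : Set ℝ}
    (hS : ∀ᵐ z ∂μ, z ∈ S)
    (hinv : ∀ x ∈ S, ∀ f : ℝ → ℝ≥0∞, ∫⁻ y, f (x + y) ∂μ = ∫⁻ y, f y ∂μ) (n : ℕ) {x₀ : ℝ}
    (hx₀ : x₀ ∈ S) : Measure.pi (fun _ : Fin n => stepLaw μ V) (positiveSet x₀ n) =
      (kappa μ V)⁻¹ ^ n * (transfer (kernel V) (siteMeasure μ 0))^[n] (fun _ => 1) x₀ := by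
  induction n generalizing x₀ with
  | zero => simp [positiveSet]
  | succ n ih =>
    set g : ℝ → ℝ≥0∞ := (Set.Ioi 0).indicator
      fun z => Measure.pi (fun _ : Fin n => stepLaw μ V) (positiveSet z n) with hg
    have inner : ∀ y, ∫⁻ x : Fin n → ℝ, (positiveSet x₀ (n + 1)).indicator 1
        (Fin.cons y x : Fin (n + 1) → ℝ) ∂(Measure.pi fun _ => stepLaw μ V) = g (x₀ + y) := by
      intro y
      by_cases hy : 0 < x₀ + y
      · have hy' : x₀ + y ∈ Set.Ioi (0 : ℝ) := hy
        rw [hg, Set.indicator_of_mem hy',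
          ← lintegral_indicator_one (measurableSet_positiveSet (x₀ + y) n)]
        refine lintegral_congr fun x => ?_
        have := cons_mem_positiveSet x₀ y x
        by_cases hx : x ∈ positiveSet (x₀ + y) n
        · rw [Set.indicator_of_mem hx, Set.indicator_of_mem (this.2 ⟨hy, hx⟩)]
          rfl
        · rw [Set.indicator_of_notMem hx, Set.indicator_of_notMem fun hc => hx (this.1 hc).2]
      · have hy' : x₀ + y ∉ Set.Ioi (0 : ℝ) := hy
        rw [hg, Set.indicator_of_notMem hy', lintegral_eq_zero_of_ae_eq_zero]
        refine Eventually.of_forall fun x => ?_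
        exact Set.indicator_of_notMem (fun hc => hy ((cons_mem_positiveSet x₀ y x).1 hc).1) _
    have hdens : Measurable fun x => EReal.exp (-V x) := hV.neg.ereal_exp
    rw [← lintegral_indicator_one (measurableSet_positiveSet x₀ (n + 1)),
      lintegral_pi_fin_succ _ (measurable_one.indicator (measurableSet_positiveSet x₀ (n + 1))),
      lintegral_congr inner]
    conv_lhs => rw [stepLaw]
    -- This version avoids the measurability of g and needs only a finite density, which holds since
    -- V never takes the value ⊥.
    rw [lintegral_smul_measure, lintegral_withDensity_eq_lintegral_mul_non_measurable _ hdens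
      (Eventually.of_forall fun x => by simp [lt_top_iff_ne_top, hbot])]
    have e1 : ∀ y, ((fun x => EReal.exp (-V x)) * fun y => g (x₀ + y)) y =
        (fun z => kernel V x₀ z * g z) (x₀ + y) := by
      intro y
      simp [kernel]
    have hm : Measurable fun z =>
        kernel V x₀ z * (transfer (kernel V) (siteMeasure μ 0))^[n] (fun _ => 1) z :=
      ((measurable_kernel hV).comp (measurable_const.prodMk measurable_id)).mul
        (measurable_transfer_iterate (measurable_kernel hV) _ measurable_const _)
    have hsite : siteMeasure μ 0 = μ.restrict (Set.Ioi 0) := by simp [siteMeasure]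
    rw [lintegral_congr e1, hinv x₀ hx₀ fun z => kernel V x₀ z * g z, pow_succ',
      Function.iterate_succ_apply', transfer, smul_eq_mul, mul_assoc,
      ← lintegral_const_mul _ hm]
    congr 1
    conv_rhs => rw [hsite]
    rw [← lintegral_indicator measurableSet_Ioi]
    refine lintegral_congr_ae (hS.mono fun z hz => ?_)
    by_cases hz0 : z ∈ Set.Ioi (0 : ℝ)
    · simp only [hg]
      rw [Set.indicator_of_mem hz0, Set.indicator_of_mem hz0, ih hz, hsite]
      ring
    · simp only [hg]
      rw [Set.indicator_of_notMem hz0, Set.indicator_of_notMem hz0, mul_zero]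

lemma ofReal_P (h : IsModel μ V) (n : ℕ) :
    ENNReal.ofReal (P μ V n) = Zfree μ V 0 n / kappa μ V ^ n := by
  have := h.sigmaFinite
  obtain ⟨S, h0, hS, hinv⟩ := h.exists_translations
  rw [Zfree_eq h.measurable h.ne_bot, div_eq_mul_inv, ENNReal.inv_pow, mul_comm,
    ← pi_stepLaw_positiveSet h.measurable h.ne_bot hS hinv n h0, P, ENNReal.ofReal_toReal (measure_ne_top _ _)]
  simp [positiveSet]

end Wetting

/-! ### The critical partition functions as renewal quantities. -/

namespace Wetting

variable {μ : Measure ℝ} {V : ℝ → EReal}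

/-- A zero sum kills every summand, and ⊤⁻¹ = 0, so either degenerate value makes q vanish. -/
lemma gam_ne_zero_and_ne_top {n : ℕ} (h : 0 < q μ V n) : gam μ V ≠ 0 ∧ gam μ V ≠ ⊤ := by
  cases n with
  | zero => simp [q] at h
  | succ n =>
    constructor
    · intro h0
      have h1 := ENNReal.tsum_eq_zero.1 h0 n
      simp [q, h1] at h
    · intro h0
      simp [q, h0] at h

/-- The first return probability `q (n + 1)` as an extended nonnegative real. -/
noncomputable def firstReturn (μ : Measure ℝ) (V : ℝ → EReal) (n : ℕ) : ℝ≥0∞ :=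
  (gam μ V)⁻¹ * (Zcon μ V 0 n * (kappa μ V)⁻¹ ^ (n + 1))

lemma q_succ (n : ℕ) : q μ V (n + 1) = (firstReturn μ V n).toReal := by
  rw [q, firstReturn, div_eq_mul_inv, ENNReal.inv_pow]

lemma tsum_firstReturn (h0 : gam μ V ≠ 0) (ht : gam μ V ≠ ⊤) : ∑' n, firstReturn μ V n = 1 := by
  simp only [firstReturn]
  rw [ENNReal.tsum_mul_left]
  simp_rw [← ENNReal.inv_pow, ← div_eq_mul_inv]
  exact ENNReal.inv_mul_cancel h0 ht

lemma firstReturn_ne_top (h0 : gam μ V ≠ 0) (ht : gam μ V ≠ ⊤) (n : ℕ) :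
    firstReturn μ V n ≠ ⊤ :=
  ENNReal.ne_top_of_tsum_ne_top (by rw [tsum_firstReturn h0 ht]; exact ENNReal.one_ne_top) n

lemma coe_eps_one (h0 : gam μ V ≠ 0) : (eps μ V 1 : ℝ≥0∞) = (gam μ V)⁻¹ := by
  rw [eps, ENNReal.coe_toNNReal]
  · simp
  · simp [h0]

/-- The critical constrained partition function as an extended nonnegative real. -/
noncomputable def conCritical (μ : Measure ℝ) (V : ℝ → EReal) : ℕ → ℝ≥0∞
  | 0 => 1
  | N + 1 => (gam μ V)⁻¹ * Zcon μ V (eps μ V 1) N * (kappa μ V)⁻¹ ^ (N + 1)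

/-- The critical free partition function as an extended nonnegative real. -/
noncomputable def freeCritical (μ : Measure ℝ) (V : ℝ → EReal) (N : ℕ) : ℝ≥0∞ :=
  Zfree μ V (eps μ V 1) N * (kappa μ V)⁻¹ ^ N

lemma ZconTilde_one (h0 : gam μ V ≠ 0) (n : ℕ) :
    ZconTilde μ V 1 n = (conCritical μ V n).toReal := by
  cases n with
  | zero => simp [ZconTilde, conCritical]
  | succ n => rw [ZconTilde, conCritical, coe_eps_one h0, div_eq_mul_inv, ENNReal.inv_pow]

lemma ZfreeTilde_one (n : ℕ) : ZfreeTilde μ V 1 n = (freeCritical μ V n).toReal := by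
  rw [ZfreeTilde, freeCritical, div_eq_mul_inv, ENNReal.inv_pow]

/-- Trajectories without an intermediate contact form the term with second index 0, which is why the
convention at 0 is the value 1. At a first contact the reward is γ⁻¹, which completes the next
factor. -/
lemma conCritical_succ (h : IsModel μ V) (h0 : gam μ V ≠ 0) (n : ℕ) :
    conCritical μ V (n + 1) =
      ∑ p ∈ antidiagonal n, firstReturn μ V p.1 * conCritical μ V p.2 := by
  have := h.sigmaFinite
  cases n with
  | zero =>
    simp only [conCritical, firstReturn, Zcon_eq h.measurable h.ne_bot]
    simp [mul_assoc]
  | succ n =>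
    have e : conCritical μ V (n + 1 + 1) = (gam μ V)⁻¹ * Zcon μ V (eps μ V 1) (n + 1) *
      (kappa μ V)⁻¹ ^ (n + 1 + 1) := rfl
    rw [Finset.Nat.sum_antidiagonal_succ', e, Zcon_succ h.measurable h.ne_bot,
      coe_eps_one h0, mul_add, add_mul, Finset.mul_sum, Finset.sum_mul]
    congr 1
    · simp [firstReturn, conCritical, mul_assoc]
    · refine Finset.sum_congr rfl fun p hp => ?_
      rw [Finset.HasAntidiagonal.mem_antidiagonal] at hp
      subst hp
      simp only [firstReturn, conCritical]
      ring

lemma freeCritical_succ (h : IsModel μ V) (h0 : gam μ V ≠ 0) (n : ℕ) :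
    freeCritical μ V (n + 1) = ENNReal.ofReal (P μ V (n + 1)) +
      ∑ p ∈ antidiagonal n, firstReturn μ V p.1 * freeCritical μ V p.2 := by
  have := h.sigmaFinite
  rw [freeCritical, Zfree_succ h.measurable h.ne_bot, ofReal_P h, add_mul, Finset.sum_mul,
    div_eq_mul_inv, ENNReal.inv_pow, coe_eps_one h0]
  congr 1
  refine Finset.sum_congr rfl fun p hp => ?_
  rw [Finset.HasAntidiagonal.mem_antidiagonal] at hp
  subst hp
  simp only [firstReturn, freeCritical]
  ring

lemma freeCritical_zero (h : IsModel μ V) : freeCritical μ V 0 = ENNReal.ofReal (P μ V 0) := by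
  have := h.sigmaFinite
  rw [ofReal_P h, freeCritical, Zfree_eq h.measurable h.ne_bot, Zfree_eq h.measurable h.ne_bot]
  simp

lemma conCritical_ne_top (h : IsModel μ V) (h0 : gam μ V ≠ 0) (ht : gam μ V ≠ ⊤) (n : ℕ) :
    conCritical μ V n ≠ ⊤ := by
  induction n using Nat.strong_induction_on with
  | _ n ih =>
    cases n with
    | zero => simp [conCritical]
    | succ n =>
      rw [conCritical_succ h h0]
      refine ENNReal.sum_ne_top.2 fun p hp => ENNReal.mul_ne_top (firstReturn_ne_top h0 ht _)
        (ih _ ?_)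
      rw [Finset.HasAntidiagonal.mem_antidiagonal] at hp
      omega

lemma freeCritical_ne_top (h : IsModel μ V) (h0 : gam μ V ≠ 0) (ht : gam μ V ≠ ⊤) (n : ℕ) :
    freeCritical μ V n ≠ ⊤ := by
  induction n using Nat.strong_induction_on with
  | _ n ih =>
    cases n with
    | zero => rw [freeCritical_zero h]; exact ENNReal.ofReal_ne_top
    | succ n =>
      rw [freeCritical_succ h h0]
      refine ENNReal.add_ne_top.2 ⟨ENNReal.ofReal_ne_top, ENNReal.sum_ne_top.2 fun p hp =>
        ENNReal.mul_ne_top (firstReturn_ne_top h0 ht _) (ih _ ?_)⟩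
      rw [Finset.HasAntidiagonal.mem_antidiagonal] at hp
      omega

lemma isRenewal_ZconTilde (h : IsModel μ V) (h0 : gam μ V ≠ 0) (ht : gam μ V ≠ ⊤) :
    IsRenewal (q μ V) (ZconTilde μ V 1) where
  zero := rfl
  nonneg n := by
    cases n with
    | zero => exact le_rfl
    | succ n => exact ENNReal.toReal_nonneg
  hasSum := by
    have h1 : HasSum (fun n => q μ V (n + 1)) 1 := by
      simp_rw [q_succ]
      have h2 := ENNReal.hasSum_toReal (f := firstReturn μ V)
        (by rw [tsum_firstReturn h0 ht]; exact ENNReal.one_ne_top)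
      rwa [← ENNReal.tsum_toReal_eq (firstReturn_ne_top h0 ht), tsum_firstReturn h0 ht,
        ENNReal.toReal_one] at h2
    have h3 := (hasSum_nat_add_iff (f := q μ V) 1).1 h1
    simpa [q] using h3
  init := rfl
  rec_succ n := by
    simp_rw [ZconTilde_one h0, q_succ]
    rw [conCritical_succ h h0, ENNReal.toReal_sum fun p _ =>
      ENNReal.mul_ne_top (firstReturn_ne_top h0 ht _) (conCritical_ne_top h h0 ht _)]
    simp_rw [ENNReal.toReal_mul]

lemma ZfreeTilde_one_succ (h : IsModel μ V) (h0 : gam μ V ≠ 0) (ht : gam μ V ≠ ⊤) (n : ℕ) :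
    ZfreeTilde μ V 1 (n + 1) = P μ V (n + 1) +
      ∑ p ∈ antidiagonal n, q μ V (p.1 + 1) * ZfreeTilde μ V 1 p.2 := by
  have hne : ∀ p ∈ antidiagonal n, firstReturn μ V p.1 * freeCritical μ V p.2 ≠ ⊤ := fun p _ =>
    ENNReal.mul_ne_top (firstReturn_ne_top h0 ht _) (freeCritical_ne_top h h0 ht _)
  simp_rw [ZfreeTilde_one, q_succ]
  rw [freeCritical_succ h h0, ENNReal.toReal_add ENNReal.ofReal_ne_top
    (ENNReal.sum_ne_top.2 hne), ENNReal.toReal_ofReal (show 0 ≤ P μ V (n + 1) from ENNReal.toReal_nonneg),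
    ENNReal.toReal_sum hne]
  simp_rw [ENNReal.toReal_mul]

/-- The decomposition of the free partition function at the last contact with the origin. -/
lemma ZfreeTilde_one_eq_sum (h : IsModel μ V) (h0 : gam μ V ≠ 0) (ht : gam μ V ≠ ⊤) (n : ℕ) :
    ZfreeTilde μ V 1 n = ∑ p ∈ antidiagonal n, ZconTilde μ V 1 p.1 * P μ V p.2 := by
  have hr := isRenewal_ZconTilde h h0 ht
  have e : PowerSeries.mk (ZfreeTilde μ V 1) = PowerSeries.mk (P μ V) +
      PowerSeries.mk (q μ V) * PowerSeries.mk (ZfreeTilde μ V 1) := by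
    ext n
    cases n with
    | zero =>
      simp [hr.zero, ZfreeTilde_one, freeCritical_zero h,
        ENNReal.toReal_ofReal (show 0 ≤ P μ V 0 from ENNReal.toReal_nonneg)]
    | succ n =>
      rw [map_add, PowerSeries.coeff_mul, PowerSeries.coeff_mk, PowerSeries.coeff_mk,
        Finset.Nat.antidiagonal_succ, Finset.sum_cons, Finset.sum_map,
        ZfreeTilde_one_succ h h0 ht]
      simp [hr.zero]
  -- Solving F = P + QF with U(1 - Q) = 1 turns the cut at the first contact into the cut at the
  -- last.
  have e2 : PowerSeries.mk (ZfreeTilde μ V 1) =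
      PowerSeries.mk (ZconTilde μ V 1) * PowerSeries.mk (P μ V) := by
    linear_combination PowerSeries.mk (ZconTilde μ V 1) * e -
      PowerSeries.mk (ZfreeTilde μ V 1) * hr.mk_mul
  have := congrArg (PowerSeries.coeff n) e2
  rw [PowerSeries.coeff_mul] at this
  simpa using this

end Wetting

/-! ### Conclusion. -/

lemma tendsto_rho_sq_div_sqrt : Tendsto (fun n : ℕ => rho n ^ 2 / Real.sqrt n) atTop (nhds 1) := by
  have h1 : Tendsto (fun n : ℕ => Real.sqrt (1 + 1 / (n : ℝ))) atTop (nhds (Real.sqrt (1 + 0))) :=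
    (tendsto_const_nhds.add (tendsto_const_nhds.div_atTop tendsto_natCast_atTop_atTop)).sqrt
  rw [add_zero, Real.sqrt_one] at h1
  refine h1.congr' ?_
  filter_upwards [eventually_gt_atTop 0] with n hn
  have : (0 : ℝ) < n := by exact_mod_cast hn
  rw [rho_sq, ← Real.sqrt_div (by positivity)]
  congr 1
  field_simp

lemma rpow_three_halves {x : ℝ} (hx : 0 ≤ x) : x ^ (3 / 2 : ℝ) = Real.sqrt x ^ 3 := by
  rw [Real.sqrt_eq_rpow, ← Real.rpow_natCast, ← Real.rpow_mul hx]
  norm_num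

theorem lemma4 (μ : Measure ℝ) (V : ℝ → EReal) (hmodel : Wetting.IsModel μ V)
    (L L' : ℝ → ℝ) (hL : SlowlyVarying L) (hL' : SlowlyVarying L')
    (c_q : ℝ) (hc : 0 < c_q)
    (hq : Wetting.q μ V ~[atTop] fun n : ℕ => c_q * (L n / (n : ℝ) ^ (3 / 2 : ℝ)))
    (hP : Wetting.P μ V ~[atTop] fun n : ℕ => L' n / Real.sqrt n) :
    (Wetting.ZconTilde μ V 1 ~[atTop]
      fun N : ℕ => 1 / (2 * Real.pi) * (1 / (c_q * L N * Real.sqrt N))) ∧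
    (Wetting.ZfreeTilde μ V 1 ~[atTop] fun N : ℕ => L' N / (2 * c_q * L N)) := by
  obtain ⟨l, hl, hlL⟩ := hL.exists_svSeq
  obtain ⟨l', hl', hlL'⟩ := hL'.exists_svSeq
  have hq1 : Tendsto (fun n => Wetting.q μ V n * rho n ^ 6 / l n) atTop (nhds c_q) := by
    have hne : ∀ᶠ n : ℕ in atTop, c_q * (L n / (n : ℝ) ^ (3 / 2 : ℝ)) ≠ 0 := by
      filter_upwards [hlL, eventually_gt_atTop 0] with n h1 hn
      have : (0 : ℝ) < n := by exact_mod_cast hn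
      rw [← h1]
      have := hl.pos n
      positivity
    have h1 := (((isEquivalent_iff_tendsto_one hne).1 hq).mul
      (tendsto_rho_sq_div_sqrt.pow 3)).mul_const c_q
    norm_num at h1
    refine h1.congr' ?_
    filter_upwards [hlL, eventually_gt_atTop 0] with n h2 hn
    have hn0 : (0 : ℝ) < n := by exact_mod_cast hn
    have := hl.pos n
    have := Real.sqrt_pos.2 hn0
    rw [rpow_three_halves hn0.le, ← h2]
    field_simp
  have hP1 : Tendsto (fun n => Wetting.P μ V n * rho n ^ 2 / l' n) atTop (nhds 1) := by
    have hne : ∀ᶠ n : ℕ in atTop, L' n / Real.sqrt n ≠ 0 := by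
      filter_upwards [hlL', eventually_gt_atTop 0] with n h1 hn
      have : (0 : ℝ) < n := by exact_mod_cast hn
      rw [← h1]
      have := hl'.pos n
      positivity
    have h1 := ((isEquivalent_iff_tendsto_one hne).1 hP).mul tendsto_rho_sq_div_sqrt
    rw [mul_one] at h1
    refine h1.congr' ?_
    filter_upwards [hlL', eventually_gt_atTop 0] with n h2 hn
    have hn0 : (0 : ℝ) < n := by exact_mod_cast hn
    have := hl'.pos n
    have := Real.sqrt_pos.2 hn0
    simp only [Pi.div_apply]
    rw [← h2]
    field_simp
  -- Finiteness of γ is extracted from the asymptotics of q: a single positive value is enough.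
  obtain ⟨n₀, hn₀⟩ := (IsRenewal.eventually_pos hl hc hq1).exists
  obtain ⟨h0, ht⟩ := Wetting.gam_ne_zero_and_ne_top hn₀
  have hr := Wetting.isRenewal_ZconTilde hmodel h0 ht
  have hu := hr.tendsto_u hl hc hq1
  constructor
  · have hne : ∀ᶠ n : ℕ in atTop, 1 / (2 * Real.pi) * (1 / (c_q * L n * Real.sqrt n)) ≠ 0 := by
      filter_upwards [hlL, eventually_gt_atTop 0] with n h1 hn
      have : (0 : ℝ) < n := by exact_mod_cast hn
      rw [← h1]
      have := hl.pos n
      positivity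
    rw [isEquivalent_iff_tendsto_one hne]
    have h1 := (hu.div tendsto_rho_sq_div_sqrt one_ne_zero).mul_const (2 * Real.pi * c_q)
    have e : 1 / (2 * Real.pi * c_q) / 1 * (2 * Real.pi * c_q) = 1 := by field_simp
    rw [e] at h1
    refine h1.congr' ?_
    filter_upwards [hlL, eventually_gt_atTop 0] with n h2 hn
    have hn0 : (0 : ℝ) < n := by exact_mod_cast hn
    have := hl.pos n
    have := rho_pos n
    have := Real.sqrt_pos.2 hn0
    simp only [Pi.div_apply]
    rw [← h2]
    field_simp
  · have hne : ∀ᶠ n : ℕ in atTop, L' n / (2 * c_q * L n) ≠ 0 := by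
      filter_upwards [hlL, hlL'] with n h1 h2
      rw [← h1, ← h2]
      have := hl.pos n
      have := hl'.pos n
      positivity
    rw [isEquivalent_iff_tendsto_one hne]
    -- The convolution constant π cancels the one in 1/(2π c), leaving the factor 1/(2c).
    have h1 := (tendsto_sum_antidiagonal_mul hl.inv hl' (a := Wetting.ZconTilde μ V 1)
      (b := Wetting.P μ V) (A := 1 / (2 * Real.pi * c_q)) (by simpa using hu) hP1).mul_const
      (2 * c_q)
    have e : Real.pi * (1 / (2 * Real.pi * c_q)) * 1 * (2 * c_q) = 1 := by field_simp
    rw [e] at h1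
    refine h1.congr' ?_
    filter_upwards [hlL, hlL'] with n h2 h3
    have := hl.pos n
    have := hl'.pos n
    rw [← Wetting.ZfreeTilde_one_eq_sum hmodel h0 ht]
    simp only [Pi.div_apply]
    rw [← h2, ← h3]
    field_simp
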